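/- Let $R$ be a Cohen--Macaulay local ring, $I\subseteq R$ an ideal of height $k\ge 2$ such that $\overline R=R/I$ is Cohen--Macaulay, and assume that both $R$ and $\overline R$ are Gorenstein. Let $\omega$ be a canonical module of $R$ and put $\overline\omega=\overline R\otimes_R\omega=\omega/I\omega$, with projection $\pi\colon\omega\to\overline\omega$. Let $$0\to IF\xrightarrow{\ \iota\ } M\xrightarrow{\ \rho\ } W\to 0$$ be an exact sequence of $R$-modules with $F$ free, $M$ finitely generated and $IW=0$ (an $I$-free approximation of $M$). Then there are a unique $\kappa\colon M\to F$ extending the inclusion $IF\hookrightarrow F$ along $\iota$ and a unique linear map $\lambda\colon \operatorname{Hom}_R(M,I\omega)\to\operatorname{Hom}_R(F,\omega)$ with $\lambda(\psi)|_{IF}=\psi\circ\iota$. Let $\alpha\colon\operatorname{Hom}_R(F,\omega)\to V$ be the cokernel of $\lambda$. There are uniquely determined maps: $\overline\alpha\colon\operatorname{Hom}_R(F,\overline\omega)\to V$ with $\overline\alpha(\pi\circ\varphi)=\alpha(\varphi)$; $\nu\colon V\to\operatorname{Hom}_R(W,\overline\omega)$ with $\nu(\alpha(\varphi))(\rho(m))=\pi(\varphi(\kappa(m)))$;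 and $\overline\lambda\colon \operatorname{Hom}_R(M,I\omega)/\operatorname{Hom}_R(F,I\omega)\to\operatorname{Hom}_R(F,\overline\omega)$ induced by $\lambda$, where $\operatorname{Hom}_R(F,I\omega)$ is mapped to $\operatorname{Hom}_R(M,I\omega)$ by composition with $\kappa$. Moreover $\overline\alpha$ is surjective, $\nu$ is injective, and the following hold. (1) Let $C\in\{\omega,R\}$, let $\beta\colon\operatorname{Ext}^{k-1}_R(IF,C)\to\operatorname{Ext}^k_R(W,C)$ and $\partial\colon\operatorname{Ext}^{k-1}_R(I,C)\to\operatorname{Ext}^k_R(\overline R,C)$ be the connecting maps of the given sequence and of $0\to I\to R\to\overline R\to0$. Then $\overline\omega\cong\operatorname{Ext}^k_R(\overline R,C)$, and for every isomorphism $\theta\colon\overline\omega\to\operatorname{Ext}^k_R(\overline R,C)$ there are isomorphisms $\Phi\colon\operatorname{Ext}^{k-1}_R(IF,C)\to\operatorname{Hom}_R(F,\overline\omega)$ and $\Gamma\colon\operatorname{Ext}^k_R(W,C)\to\operatorname{Hom}_R(W,\overline\omega)$ such that $$\theta\bigl(\Phi((\varphi|_{IF})^*\xi)(f)\bigr)=\varphi(f)\,\partial\xi,\qquad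 \theta\bigl(\Gamma(\eta)(w)\bigr)=(\overline r\mapsto rw)^*\eta,\qquad \Gamma\circ\beta=\nu\circ\overline\alpha\circ\Phi$$ for all $\varphi\in\operatorname{Hom}_R(F,R)$, $\xi\in\operatorname{Ext}^{k-1}_R(I,C)$, $f\in F$, $\eta\in\operatorname{Ext}^k_R(W,C)$, $w\in W$, where $\varphi|_{IF}$ is regarded as a map $IF\to I$ and $\overline r\mapsto rw$ as a map $\overline R\to W$. Thus $\beta$, as a map onto its image, is identified with $\overline\alpha$, and its image with $V$. (2) $\operatorname{Ext}^{k-1}_R(M,R)\cong\ker(\overline\alpha)$, and $\overline\lambda$ is an isomorphism of $\operatorname{Hom}_R(M,I\omega)/\operatorname{Hom}_R(F,I\omega)$ onto $\ker(\overline\alpha)$. (3) If $M$ is $I$-reflexive, that is, if the evaluation map $M\to\operatorname{Hom}_R(\operatorname{Hom}_R(M,I\omega),I\omega)$ is an isomorphism, then $\operatorname{Ext}^k_R(M,R)=0$ if and only if $V$ is $\overline\omega$-reflexive, that is, the evaluation map $V\to\operatorname{Hom}_R(\operatorname{Hom}_R(V,\overline\omega),\overline\omega)$ is an isomorphism. 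-/

import Mathlib

open CategoryTheory

universe u

namespace ResidualDuality

/-! ### Maximal Cohen-Macaulay modules, Cohen-Macaulay and Gorenstein local rings, canonical modules -/

/-- A finitely generated module `M` over a local ring `R` is maximal Cohen-Macaulay if there is an
`M`-regular sequence in the maximal ideal whose length is the Krull dimension of `R`. -/
structure IsMaximalCohenMacaulay (R : Type u) [CommRing R] [IsLocalRing R]
    (M : Type u) [AddCommGroup M] [Module R M] : Prop where
  finite : Module.Finite R M
  exists_regular : ∃ rs : List R, (∀ r ∈ rs, r ∈ IsLocalRing.maximalIdeal R) ∧
    RingTheory.Sequence.IsRegular M rs ∧ ringKrullDim R = (rs.length : WithBot ℕ∞)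

/-- Cohen-Macaulay (Noetherian) local rings. -/
structure IsCohenMacaulayLocalRing (R : Type u) [CommRing R] : Prop
    extends IsLocalRing R, IsNoetherianRing R where
  maximalCohenMacaulay : IsMaximalCohenMacaulay R R

/-- An `R`-module has finite injective dimension. -/
def HasFiniteInjectiveDimension (R : Type u) [CommRing R]
    (M : Type u) [AddCommGroup M] [Module R M] : Prop :=
  ∃ n : ℕ, HasInjectiveDimensionLT (ModuleCat.of R M) n

/-- Gorenstein local rings: Noetherian local rings of finite injective dimension over themselves. -/
structure IsGorensteinLocalRing (R : Type u) [CommRing R] : Prop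
    extends IsLocalRing R, IsNoetherianRing R where
  finite_injectiveDimension : HasFiniteInjectiveDimension R R

/-- The `R`-module `Ext^i_R(M, N)`. -/
abbrev ExtMod (R : Type u) [CommRing R] (M N : Type u) [AddCommGroup M] [Module R M]
    [AddCommGroup N] [Module R N] (i : ℕ) : Type u :=
  Abelian.Ext.{u} (ModuleCat.of R M) (ModuleCat.of R N) i

/-- A canonical module of a local ring `R` (in practice Cohen-Macaulay) with residue field `κ`:
a maximal Cohen-Macaulay module of finite injective dimension and of type one, that is,
`Ext^d_R(κ, ω)` with `d = dim R` is one-dimensional over `κ`. -/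
structure IsCanonicalModule (R : Type u) [CommRing R] [IsLocalRing R]
    (ω : Type u) [AddCommGroup ω] [Module R ω] : Prop where
  maximalCohenMacaulay : IsMaximalCohenMacaulay R ω
  finite_injectiveDimension : HasFiniteInjectiveDimension R ω
  type_one : ∃ d : ℕ, ringKrullDim R = (d : WithBot ℕ∞) ∧
    Nonempty (ExtMod R (IsLocalRing.ResidueField R) ω d ≃ₗ[R] IsLocalRing.ResidueField R)

/-! ### Functoriality of `Ext` in the first argument -/

section Ext

variable {R : Type u} [CommRing R] {A B : Type u} [AddCommGroup A] [Module R A]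
  [AddCommGroup B] [Module R B] (C : Type u) [AddCommGroup C] [Module R C]

/-- The map `f^* : Ext^i_R(B, C) → Ext^i_R(A, C)` induced by `f : A → B`. -/
noncomputable def extPullback (f : A →ₗ[R] B) (i : ℕ) : ExtMod R B C i →ₗ[R] ExtMod R A C i :=
  Abelian.Ext.precompOfLinear (Abelian.Ext.mk₀ (ModuleCat.ofHom f)) R (ModuleCat.of R C) (zero_add i)

/-- The short complex in `ModuleCat R` attached to linear maps with `g ∘ f = 0`. -/
abbrev shortComplex {D : Type u} [AddCommGroup D] [Module R D] (f : A →ₗ[R] B) (g : B →ₗ[R] D)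
    (h : Function.Exact f g) : ShortComplex (ModuleCat.{u} R) :=
  ShortComplex.mk (ModuleCat.ofHom f) (ModuleCat.ofHom g)
    (by rw [← ModuleCat.ofHom_comp, h.linearMap_comp_eq_zero]; rfl)

theorem shortComplex_shortExact {D : Type u} [AddCommGroup D] [Module R D] (f : A →ₗ[R] B)
    (g : B →ₗ[R] D) (hf : Function.Injective f) (h : Function.Exact f g)
    (hg : Function.Surjective g) : (shortComplex f g h).ShortExact where
  exact := (ShortComplex.ShortExact.moduleCat_exact_iff_function_exact _).2 h
  mono_f := (ModuleCat.mono_iff_injective _).2 hf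
  epi_g := (ModuleCat.epi_iff_surjective _).2 hg

/-- The connecting map `Ext^i_R(A, C) → Ext^j_R(D, C)`, `j = i + 1`, of a short exact sequence
`0 → A → B → D → 0`. -/
noncomputable def extConnecting {D : Type u} [AddCommGroup D] [Module R D] (f : A →ₗ[R] B)
    (g : B →ₗ[R] D) (hf : Function.Injective f) (h : Function.Exact f g)
    (hg : Function.Surjective g) {i j : ℕ} (hij : 1 + i = j) :
    ExtMod R A C i →ₗ[R] ExtMod R D C j :=
  Abelian.Ext.precompOfLinear (shortComplex_shortExact f g hf h hg).extClass R
    (ModuleCat.of R C) hij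

end Ext

/-! ### Reflexivity -/

/-- `M` is `N`-reflexive: the evaluation map `M → Hom(Hom(M, N), N)`, `m ↦ (φ ↦ φ m)`, is
bijective. -/
def IsReflexiveWith (R : Type u) [CommRing R] (M N : Type u) [AddCommGroup M] [Module R M]
    [AddCommGroup N] [Module R N] : Prop :=
  Function.Bijective
    ((LinearMap.id : (M →ₗ[R] N) →ₗ[R] (M →ₗ[R] N)).flip : M →ₗ[R] (M →ₗ[R] N) →ₗ[R] N)

/-! ### `I`-free approximations -/

section Approximation

variable {R : Type u} [CommRing R] (I : Ideal R)

/-- The submodule `I N` of a module `N`. -/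
abbrev idealMul (N : Type u) [AddCommGroup N] [Module R N] : Submodule R N := I • ⊤

/-- The module `N / I N`, that is, `R/I ⊗ N`. -/
abbrev reduction (N : Type u) [AddCommGroup N] [Module R N] : Type u := N ⧸ idealMul I N

variable (F M W : Type u) [AddCommGroup F] [Module R F] [AddCommGroup M] [Module R M]
  [AddCommGroup W] [Module R W]

/-- A short exact sequence `0 → I F → M → W → 0` with `I W = 0`. It is an `I`-free approximation
of `M` if `F` is free and `M` is finitely generated. -/
structure Approximation where
  iota : idealMul I F →ₗ[R] M
  rho : M →ₗ[R] W
  iota_injective : Function.Injective iota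
  exact : Function.Exact iota rho
  rho_surjective : Function.Surjective rho
  smul_eq_zero : ∀ r ∈ I, ∀ w : W, r • w = 0

variable {I F M W} (A : Approximation I F M W) (ω : Type u) [AddCommGroup ω] [Module R ω]

/-- For `κ : M → F`, the map `Hom(F, Iω) → Hom(M, Iω)`, `φ ↦ φ ∘ κ`. -/
abbrev precompKappa (κ : M →ₗ[R] F) :
    (F →ₗ[R] idealMul I ω) →ₗ[R] (M →ₗ[R] idealMul I ω) :=
  LinearMap.lcomp R (idealMul I ω) κ

/-- The maps attached to an `I`-free approximation `0 → I F → M → W → 0` and to `ω`; each of them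
is determined by the equation that follows it. Here `π : ω → ω / I ω` is the projection.

* `kappa : M → F` extends the inclusion `I F → F` along `iota`;
* `lam : Hom(M, Iω) → Hom(F, ω)` sends `ψ` to the map whose restriction to `I F` is `ψ ∘ iota`;
  the cokernel of `lam` is `V`, with projection `α : Hom(F, ω) → V`;
* `alphaBar : Hom(F, ω/Iω) → V` is induced by `α`;
* `lamBar : Hom(M, Iω) / Hom(F, Iω) → Hom(F, ω/Iω)` is induced by `lam`, where `Hom(F, Iω)` is
  mapped to `Hom(M, Iω)` by composition with `kappa`;
* `nu : V → Hom(W, ω/Iω)` sends `α φ` to the map induced by `π ∘ φ ∘ kappa`. -/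
structure DualDiagram where
  kappa : M →ₗ[R] F
  kappa_iota : ∀ x : idealMul I F, kappa (A.iota x) = (x : F)
  lam : (M →ₗ[R] idealMul I ω) →ₗ[R] (F →ₗ[R] ω)
  lam_apply : ∀ (ψ : M →ₗ[R] idealMul I ω) (x : idealMul I F),
    lam ψ (x : F) = (ψ (A.iota x) : ω)
  alphaBar : (F →ₗ[R] reduction I ω) →ₗ[R] ((F →ₗ[R] ω) ⧸ LinearMap.range lam)
  alphaBar_comp : ∀ φ : F →ₗ[R] ω,
    alphaBar ((idealMul I ω).mkQ ∘ₗ φ) = (LinearMap.range lam).mkQ φ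
  lamBar : ((M →ₗ[R] idealMul I ω) ⧸ LinearMap.range (precompKappa ω kappa)) →ₗ[R]
    (F →ₗ[R] reduction I ω)
  lamBar_mk : ∀ ψ : M →ₗ[R] idealMul I ω,
    lamBar ((LinearMap.range (precompKappa ω kappa)).mkQ ψ) = (idealMul I ω).mkQ ∘ₗ lam ψ
  nu : ((F →ₗ[R] ω) ⧸ LinearMap.range lam) →ₗ[R] (W →ₗ[R] reduction I ω)
  nu_mk : ∀ (φ : F →ₗ[R] ω) (m : M),
    nu ((LinearMap.range lam).mkQ φ) (A.rho m) = (idealMul I ω).mkQ (φ (kappa m))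

/-- The module `V`, the cokernel of `lam`. -/
abbrev DualDiagram.V {A : Approximation I F M W} {ω : Type u} [AddCommGroup ω] [Module R ω]
    (D : DualDiagram A ω) : Type u :=
  (F →ₗ[R] ω) ⧸ LinearMap.range D.lam

/-! ### The connecting maps and the canonical identifications -/

/-- The map `β : Ext^i_R(I F, C) → Ext^j_R(W, C)`, `j = i + 1`, of `0 → I F → M → W → 0`. -/
noncomputable def Approximation.beta (C : Type u) [AddCommGroup C] [Module R C] {i j : ℕ}
    (hij : 1 + i = j) : ExtMod R (idealMul I F) C i →ₗ[R] ExtMod R W C j :=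
  extConnecting C A.iota A.rho A.iota_injective A.exact A.rho_surjective hij

variable (I) in
/-- The map `∂ : Ext^i_R(I, C) → Ext^j_R(R/I, C)`, `j = i + 1`, of `0 → I → R → R/I → 0`. -/
noncomputable def idealConnecting (C : Type u) [AddCommGroup C] [Module R C] {i j : ℕ}
    (hij : 1 + i = j) : ExtMod R I C i →ₗ[R] ExtMod R (R ⧸ I) C j :=
  extConnecting C (Submodule.subtype I) (Submodule.mkQ I) (Submodule.injective_subtype I)
    (LinearMap.exact_subtype_mkQ I) (Submodule.mkQ_surjective I) hij

/-- The restriction `I F → I` of a linear form `φ : F → R`. -/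
def restrictForm (φ : F →ₗ[R] R) : idealMul I F →ₗ[R] I :=
  φ.restrict (q := I) (fun x hx => by
    have h : I • (⊤ : Submodule R F) ≤ Submodule.comap φ I :=
      Submodule.smul_le.2 fun r hr f _ => by
        simpa using I.mul_mem_right (φ f) hr
    exact h hx)

/-- For `w ∈ W`, the map `R/I → W`, `r ↦ r w`. -/
def Approximation.orbit (w : W) : (R ⧸ I) →ₗ[R] W :=
  Submodule.liftQ I (LinearMap.toSpanSingleton R W w) (fun r hr => by
    simpa using A.smul_eq_zero r hr w)

/-- The connecting map `β : Ext^{k-1}_R(I F, C) → Ext^k_R(W, C)` is canonically identified with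
`alphaBar : Hom(F, ω/Iω) → V ⊆ Hom(W, ω/Iω)`.

Write `E = Ext^k_R(R/I, C)`. There is an isomorphism `θ : ω/Iω ≅ E`, and whichever one is chosen,
there are isomorphisms `Φ : Ext^{k-1}_R(I F, C) ≅ Hom(F, ω/Iω)` and
`Γ : Ext^k_R(W, C) ≅ Hom(W, ω/Iω)` such that

* `θ (Φ ((φ|_{I F})^* ξ) f) = φ f • ∂ ξ` for `φ : F → R`, `ξ ∈ Ext^{k-1}_R(I, C)`, `f ∈ F`,
* `θ (Γ η w) = (r ↦ r w)^* η` for `η ∈ Ext^k_R(W, C)`, `w ∈ W`,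
* `Γ ∘ β = nu ∘ alphaBar ∘ Φ`.

The first equation reads `Hom(F, R) ⊗ Ext^{k-1}_R(I, C) ≅ Ext^{k-1}_R(I F, C)` and
`∂ : Ext^{k-1}_R(I, C) ≅ E`, and the second one `Ext^k_R(W, C) ≅ Hom(W, E)`. -/
def ConnectingMapIsAlphaBar {A : Approximation I F M W} {ω : Type u} [AddCommGroup ω]
    [Module R ω] (D : DualDiagram A ω) (C : Type u) [AddCommGroup C] [Module R C] (k : ℕ)
    (hk : 1 + (k - 1) = k) : Prop :=
  Nonempty (reduction I ω ≃ₗ[R] ExtMod R (R ⧸ I) C k) ∧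
  ∀ θ : reduction I ω ≃ₗ[R] ExtMod R (R ⧸ I) C k,
    ∃ (Φ : ExtMod R (idealMul I F) C (k - 1) ≃ₗ[R] (F →ₗ[R] reduction I ω))
      (Γ : ExtMod R W C k ≃ₗ[R] (W →ₗ[R] reduction I ω)),
      (∀ (φ : F →ₗ[R] R) (ξ : ExtMod R I C (k - 1)) (f : F),
        θ (Φ (extPullback C (restrictForm φ) (k - 1) ξ) f) = φ f • idealConnecting I C hk ξ) ∧
      (∀ (η : ExtMod R W C k) (w : W), θ (Γ η w) = extPullback C (A.orbit w) k η) ∧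
      (∀ ζ : ExtMod R (idealMul I F) C (k - 1),
        Γ (A.beta C hk ζ) = D.nu (D.alphaBar (Φ ζ)))

end Approximation

end ResidualDuality

open ResidualDuality

/-!
Over a Gorenstein local ring `R` a canonical module is isomorphic to `R`, and `R/I` has
`Ext^i(R/I, R) = 0` for `i ≠ k` and `Ext^k(R/I, R) ≃ R/I`. The theorem follows from these two facts
and the long exact sequence of `Ext(-, C)` in the first argument.

Both facts come from one duality argument. Let `N` be maximal Cohen-Macaulay of finite injective
dimension and `d = dim R`. Then `Ext^i(κ, N) = 0` for `i ≠ d`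
(`subsingleton_ext_residueField`), so that `T = Ext^d(-, N)` is exact on modules of finite length;
hence `length (T X) = length X * length (T κ)`, and the number of generators of `T X` is
`length (socle X) * length (T κ)` (`length_ext_quotient`). For `N = R` and the quotient `X` of `R`
by a maximal regular sequence, `T X ≃ X` has one generator, so that `X` has a simple socle and
`T κ` length one (`length_socle_mul_length_ext_eq_one`). If `T κ` has length one, then `T Y ≃ Y` for
every cyclic `Y` of finite length with simple socle, and going up along a regular sequence,
`Ext^c(Y, N) ≃ Y` for cyclic `Y` that have such a quotient (`ext_equiv_of_regular`). This applies to
`Y = R`, `N = ω` and to `Y = R/I`, `N = R`.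

By dévissage, `Ext^i(X, C) = 0` for `i < k` and `Ext^k(X, C) ≃ Hom(X, Ext^k(R/I, C))` for finite `X`
killed by `I` and `C ∈ {ω, R}` (`subsingleton_ext_of_smul_eq_zero`, `extOrbit_bijective`). As
`2 ≤ k`, linear maps to `R` and to `ω` extend uniquely from `I F` to `M` and to `F`, which gives
`kappa` and `lam` and, on quotients, the other maps of the diagram (`nonempty_dualDiagram`). The
isomorphism `Γ` is the dévissage isomorphism for `W`, and `Φ` is composed of the one for `F / I F`
and the connecting map of `0 → I F → F → F / I F → 0`; the equations of part (1) are
instances of naturality (`connectingMapIsAlphaBar`).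

The exact sequence `0 → Ext^{k-1}(M, R) → Ext^{k-1}(I F, R) → Ext^k(W, R) → Ext^k(M, R) → 0` then
gives part (2), and it shows that `Ext^k(M, R) = 0` if and only if `nu` is surjective. If `M` is
`I`-reflexive, then `nu` also identifies `W` with `Hom(V, ω/Iω)`
(`DualDiagram.flip_nu_injective`, `DualDiagram.flip_nu_surjective`). Under this identification `nu`
is the evaluation map of `V`, so that `V` is reflexive if and only if `nu` is bijective.
-/

namespace ResidualDuality

/-! ### Functoriality and long exact sequence of `Ext` in the first argument -/

section ExtFunctoriality

variable {R : Type u} [CommRing R] {A B D : Type u} [AddCommGroup A] [Module R A]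
  [AddCommGroup B] [Module R B] [AddCommGroup D] [Module R D]
  (C : Type u) [AddCommGroup C] [Module R C]

theorem extPullback_apply (f : A →ₗ[R] B) (i : ℕ) (x : ExtMod R B C i) :
    extPullback C f i x = (Abelian.Ext.mk₀ (ModuleCat.ofHom f)).comp x (zero_add i) := rfl

theorem extPullback_id (i : ℕ) (x : ExtMod R A C i) :
    extPullback C (LinearMap.id : A →ₗ[R] A) i x = x := by
  rw [extPullback_apply, ModuleCat.ofHom_id, Abelian.Ext.mk₀_id_comp]

theorem extPullback_comp (f : A →ₗ[R] B) (g : B →ₗ[R] D) (i : ℕ) (x : ExtMod R D C i) :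
    extPullback C (g ∘ₗ f) i x = extPullback C f i (extPullback C g i x) := by
  rw [extPullback_apply, extPullback_apply, extPullback_apply, ModuleCat.ofHom_comp,
    Abelian.Ext.mk₀_comp_mk₀_assoc]

theorem extPullback_add (f g : A →ₗ[R] B) (i : ℕ) (x : ExtMod R B C i) :
    extPullback C (f + g) i x = extPullback C f i x + extPullback C g i x := by
  rw [extPullback_apply, ModuleCat.ofHom_add, Abelian.Ext.mk₀_add, Abelian.Ext.add_comp]; rfl

theorem extPullback_smul (r : R) (f : A →ₗ[R] B) (i : ℕ) (x : ExtMod R B C i) :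
    extPullback C (r • f) i x = r • extPullback C f i x := by
  rw [extPullback_apply, show ModuleCat.ofHom (r • f) = r • ModuleCat.ofHom f from rfl,
    Abelian.Ext.mk₀_smul, Abelian.Ext.smul_comp]; rfl

theorem extPullback_zero (i : ℕ) (x : ExtMod R B C i) :
    extPullback C (0 : A →ₗ[R] B) i x = 0 := by
  have := extPullback_smul C (0 : R) (0 : A →ₗ[R] B) i x
  rwa [zero_smul, zero_smul] at this

theorem extPullback_sum {ι : Type*} (s : Finset ι) (f : ι → A →ₗ[R] B) (i : ℕ)
    (x : ExtMod R B C i) :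
    extPullback C (∑ j ∈ s, f j) i x = ∑ j ∈ s, extPullback C (f j) i x := by
  classical
  induction s using Finset.induction_on with
  | empty => simpa using extPullback_zero C i x
  | insert a s ha ih => rw [Finset.sum_insert ha, Finset.sum_insert ha, extPullback_add, ih]

/-- Isomorphic modules have isomorphic `Ext` modules into `C`. -/
noncomputable def extPullbackEquiv (e : A ≃ₗ[R] B) (i : ℕ) : ExtMod R B C i ≃ₗ[R] ExtMod R A C i :=
  LinearEquiv.ofLinearMap (extPullback C e.toLinearMap i) (extPullback C e.symm.toLinearMap i)
    (LinearMap.ext fun x => by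
      rw [LinearMap.comp_apply, ← extPullback_comp, LinearEquiv.symm_comp]
      exact extPullback_id C i x)
    (LinearMap.ext fun x => by
      rw [LinearMap.comp_apply, ← extPullback_comp, LinearEquiv.comp_symm]
      exact extPullback_id C i x)

/-- Isomorphic modules `C` have isomorphic modules `Ext(A, C)`. -/
noncomputable def extTargetEquiv {C C' : Type u} [AddCommGroup C] [Module R C] [AddCommGroup C']
    [Module R C'] (e : C ≃ₗ[R] C') (i : ℕ) : ExtMod R A C i ≃ₗ[R] ExtMod R A C' i :=
  LinearEquiv.ofLinearMap
    (Abelian.Ext.postcompOfLinear (Abelian.Ext.mk₀ (ModuleCat.ofHom e.toLinearMap)) R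
      (ModuleCat.of R A) (add_zero i))
    (Abelian.Ext.postcompOfLinear (Abelian.Ext.mk₀ (ModuleCat.ofHom e.symm.toLinearMap)) R
      (ModuleCat.of R A) (add_zero i))
    (LinearMap.ext fun x => by
      simp [← ModuleCat.ofHom_comp])
    (LinearMap.ext fun x => by
      simp [← ModuleCat.ofHom_comp])

/-- `Ext^0(A, C) = Hom(A, C)`. -/
noncomputable def extZeroEquiv : ExtMod R A C 0 ≃ₗ[R] (A →ₗ[R] C) :=
  (Abelian.Ext.linearEquiv₀ (R := R)).trans ModuleCat.homLinearEquiv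

theorem extPullback_extZeroEquiv_symm (f : A →ₗ[R] B) (h : B →ₗ[R] C) :
    extPullback C f 0 ((extZeroEquiv C).symm h) = (extZeroEquiv C).symm (h ∘ₗ f) := by
  exact Abelian.Ext.mk₀_comp_mk₀ (ModuleCat.ofHom f) (ModuleCat.ofHom h)

theorem extZeroEquiv_extPullback (f : A →ₗ[R] B) (x : ExtMod R B C 0) :
    extZeroEquiv C (extPullback C f 0 x) = extZeroEquiv C x ∘ₗ f := by
  obtain ⟨h, rfl⟩ := (extZeroEquiv C).symm.surjective x
  rw [extPullback_extZeroEquiv_symm]; simp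

theorem subsingleton_ext_of_projective [Module.Projective R A] (i : ℕ) :
    Subsingleton (ExtMod R A C (i + 1)) :=
  Abelian.Ext.subsingleton_of_projective (ModuleCat.of R A) (ModuleCat.of R C) i

/-- An element of `R` that kills `A` kills `Ext(A, C)`. -/
theorem smul_ext_eq_zero {r : R} (hr : ∀ a : A, r • a = 0) (i : ℕ) (x : ExtMod R A C i) :
    r • x = 0 := by
  have h : r • (LinearMap.id : A →ₗ[R] A) = 0 := LinearMap.ext fun a => hr a
  rw [← extPullback_id C i x, ← extPullback_smul, h, extPullback_zero]

theorem extPullback_zero_injective {g : B →ₗ[R] D} (hg : Function.Surjective g) :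
    Function.Injective (extPullback C g 0) := by
  intro x y hxy
  apply (extZeroEquiv C).injective
  have := congrArg (extZeroEquiv C) hxy
  rw [extZeroEquiv_extPullback, extZeroEquiv_extPullback] at this
  exact (LinearMap.cancel_right hg).1 this

variable (f : A →ₗ[R] B) (g : B →ₗ[R] D) (hf : Function.Injective f) (h : Function.Exact f g)
  (hg : Function.Surjective g)

include hf h hg

theorem ext_exact_pullback (i : ℕ) :
    Function.Exact (extPullback C g i) (extPullback C f i) := by
  intro x
  constructor
  · intro hx
    obtain ⟨y, hy⟩ := Abelian.Ext.contravariant_sequence_exact₂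
      (shortComplex_shortExact f g hf h hg) (Y := ModuleCat.of R C) x hx
    exact ⟨y, hy⟩
  · rintro ⟨y, rfl⟩
    rw [← extPullback_comp, h.linearMap_comp_eq_zero, extPullback_zero]

theorem ext_exact_pullback_connecting {i j : ℕ} (hij : 1 + i = j) :
    Function.Exact (extPullback C f i) (extConnecting C f g hf h hg hij) := by
  intro x
  constructor
  · intro hx
    obtain ⟨y, hy⟩ := Abelian.Ext.contravariant_sequence_exact₁
      (shortComplex_shortExact f g hf h hg) (Y := ModuleCat.of R C) x hij hx
    exact ⟨y, hy⟩
  · rintro ⟨y, rfl⟩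
    exact (shortComplex_shortExact f g hf h hg).extClass_comp_assoc y (h := hij)

theorem ext_exact_connecting_pullback {i j : ℕ} (hij : 1 + i = j) :
    Function.Exact (extConnecting C f g hf h hg hij) (extPullback C g j) := by
  intro x
  constructor
  · intro hx
    obtain ⟨y, hy⟩ := Abelian.Ext.contravariant_sequence_exact₃
      (shortComplex_shortExact f g hf h hg) (Y := ModuleCat.of R C) x hx hij
    exact ⟨y, hy⟩
  · rintro ⟨y, rfl⟩
    exact (shortComplex_shortExact f g hf h hg).comp_extClass_assoc y hij

theorem subsingleton_ext_middle (i : ℕ) [Subsingleton (ExtMod R A C i)]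
    [Subsingleton (ExtMod R D C i)] : Subsingleton (ExtMod R B C i) := by
  refine subsingleton_of_forall_eq 0 fun x => ?_
  obtain ⟨y, rfl⟩ := (ext_exact_pullback C f g hf h hg i x).1 (Subsingleton.elim _ _)
  rw [Subsingleton.elim y 0, map_zero]

theorem extPullback_surjective {i j : ℕ} (hij : 1 + i = j) [Subsingleton (ExtMod R D C j)] :
    Function.Surjective (extPullback C f i) := fun x =>
  (ext_exact_pullback_connecting C f g hf h hg hij x).1 (Subsingleton.elim _ _)

theorem extPullback_injective {i j : ℕ} (hij : 1 + i = j) [Subsingleton (ExtMod R A C i)] :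
    Function.Injective (extPullback C g j) := by
  rw [injective_iff_map_eq_zero]
  intro x hx
  obtain ⟨y, rfl⟩ := (ext_exact_connecting_pullback C f g hf h hg hij x).1 hx
  rw [Subsingleton.elim y 0, map_zero]

theorem extConnecting_surjective {i j : ℕ} (hij : 1 + i = j) [Subsingleton (ExtMod R B C j)] :
    Function.Surjective (extConnecting C f g hf h hg hij) := fun x =>
  (ext_exact_connecting_pullback C f g hf h hg hij x).1 (Subsingleton.elim _ _)

theorem extConnecting_injective {i j : ℕ} (hij : 1 + i = j) [Subsingleton (ExtMod R B C i)] :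
    Function.Injective (extConnecting C f g hf h hg hij) := by
  rw [injective_iff_map_eq_zero]
  intro x hx
  obtain ⟨y, rfl⟩ := (ext_exact_pullback_connecting C f g hf h hg hij x).1 hx
  rw [Subsingleton.elim y 0, map_zero]

/-- Naturality of the connecting map with respect to a morphism of short exact sequences. -/
theorem extConnecting_naturality {A' B' D' : Type u} [AddCommGroup A'] [Module R A']
    [AddCommGroup B'] [Module R B'] [AddCommGroup D'] [Module R D']
    (f' : A' →ₗ[R] B') (g' : B' →ₗ[R] D') (hf' : Function.Injective f')
    (h' : Function.Exact f' g') (hg' : Function.Surjective g')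
    (a : A →ₗ[R] A') (b : B →ₗ[R] B') (d : D →ₗ[R] D') (hab : f' ∘ₗ a = b ∘ₗ f)
    (hbd : g' ∘ₗ b = d ∘ₗ g) {i j : ℕ} (hij : 1 + i = j) (x : ExtMod R A' C i) :
    extConnecting C f g hf h hg hij (extPullback C a i x) =
      extPullback C d j (extConnecting C f' g' hf' h' hg' hij x) := by
  let φ : shortComplex f g h ⟶ shortComplex f' g' h' :=
    { τ₁ := ModuleCat.ofHom a
      τ₂ := ModuleCat.ofHom b
      τ₃ := ModuleCat.ofHom d
      comm₁₂ := by
        simp only [shortComplex, ← ModuleCat.ofHom_comp, hab]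
      comm₂₃ := by
        simp only [shortComplex, ← ModuleCat.ofHom_comp, hbd] }
  have key := ShortComplex.ShortExact.extClass_naturality
    (shortComplex_shortExact f g hf h hg) (shortComplex_shortExact f' g' hf' h' hg') φ
  change (shortComplex_shortExact f g hf h hg).extClass.comp
    ((Abelian.Ext.mk₀ φ.τ₁).comp x (zero_add i)) hij = (Abelian.Ext.mk₀ φ.τ₃).comp
      ((shortComplex_shortExact f' g' hf' h' hg').extClass.comp x hij) (zero_add j)
  rw [← Abelian.Ext.comp_assoc (a₁₂ := 1) _ _ _ (by lia) (by lia) (by lia), key,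
    Abelian.Ext.comp_assoc (a₂₃ := j) _ _ _ (by lia) hij (by lia)]

end ExtFunctoriality

/-! ### `Ext` of modules of finite length -/

section FiniteLength

open IsLocalRing Pointwise RingTheory.Sequence

variable {R : Type u} [CommRing R] [IsLocalRing R]

theorem nonempty_linearEquiv_residueField (X : Type u) [AddCommGroup X] [Module R X]
    [IsSimpleModule R X] : Nonempty (X ≃ₗ[R] ResidueField R) := by
  obtain ⟨m, hm, ⟨e⟩⟩ := isSimpleModule_iff_quot_maximal.mp (inferInstance : IsSimpleModule R X)
  obtain rfl := eq_maximalIdeal hm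
  exact ⟨e⟩

instance isSimpleModule_residueField : IsSimpleModule R (ResidueField R) :=
  isSimpleModule_iff_quot_maximal.mpr ⟨maximalIdeal R, inferInstance, ⟨LinearEquiv.refl _ _⟩⟩

variable (N : Type u) [AddCommGroup N] [Module R N]

/-- By induction on a composition series. -/
theorem subsingleton_ext_of_isFiniteLength (i : ℕ)
    (h : Subsingleton (ExtMod R (ResidueField R) N i)) {X : Type u} [AddCommGroup X] [Module R X]
    (hX : IsFiniteLength R X) : Subsingleton (ExtMod R X N i) := by
  induction hX with
  | @of_subsingleton M _ _ _ =>
    refine subsingleton_of_forall_eq 0 fun x => ?_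
    rw [← extPullback_id N i x, Subsingleton.elim (LinearMap.id : M →ₗ[R] M) 0, extPullback_zero]
  | @of_simple_quotient M _ _ M' _ _ ih =>
    obtain ⟨e⟩ := nonempty_linearEquiv_residueField (R := R) (M ⧸ M')
    have := (extPullbackEquiv N e i).symm.toEquiv.subsingleton
    exact subsingleton_ext_middle N M'.subtype M'.mkQ M'.injective_subtype
      (LinearMap.exact_subtype_mkQ M') M'.mkQ_surjective i

/-- If `Ext^i(κ, N)` vanishes for `i ≠ d`, then `Ext^d(-, N)` is exact on modules of finite length,
so that it multiplies lengths by the length of `Ext^d(κ, N)`. -/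
theorem length_ext_of_isFiniteLength (d : ℕ)
    (h : ∀ i ≠ d, Subsingleton (ExtMod R (ResidueField R) N i))
    {X : Type u} [AddCommGroup X] [Module R X] (hX : IsFiniteLength R X) :
    Module.length R (ExtMod R X N d) =
      Module.length R X * Module.length R (ExtMod R (ResidueField R) N d) := by
  induction hX with
  | @of_subsingleton M _ _ _ =>
    have : Subsingleton (ExtMod R M N d) := by
      refine subsingleton_of_forall_eq 0 fun x => ?_
      rw [← extPullback_id N d x, Subsingleton.elim (LinearMap.id : M →ₗ[R] M) 0,
        extPullback_zero]
    simp
  | @of_simple_quotient M _ _ M' _ hM' ih =>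
    obtain ⟨e⟩ := nonempty_linearEquiv_residueField (R := R) (M ⧸ M')
    have hs : Subsingleton (ExtMod R (M ⧸ M') N (d + 1)) :=
      have := h (d + 1) (by omega)
      (extPullbackEquiv N e _).symm.toEquiv.subsingleton
    have hinj : Function.Injective (extPullback N M'.mkQ d) := by
      rcases Nat.eq_zero_or_pos d with rfl | hd
      · exact extPullback_zero_injective N M'.mkQ_surjective
      · have := subsingleton_ext_of_isFiniteLength N (d - 1) (h _ (by omega)) hM'
        exact extPullback_injective N M'.subtype M'.mkQ M'.injective_subtype
          (LinearMap.exact_subtype_mkQ M') M'.mkQ_surjective (i := d - 1) (by omega)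
    have hsurj : Function.Surjective (extPullback N M'.subtype d) :=
      extPullback_surjective N M'.subtype M'.mkQ M'.injective_subtype
          (LinearMap.exact_subtype_mkQ M') M'.mkQ_surjective (i := d) (add_comm 1 d)
    rw [Module.length_eq_add_of_exact _ _ hinj hsurj (ext_exact_pullback N M'.subtype M'.mkQ
      M'.injective_subtype (LinearMap.exact_subtype_mkQ M') M'.mkQ_surjective d), ih,
      (extPullbackEquiv N e d).symm.length_eq,
      Module.length_eq_add_of_exact M'.subtype M'.mkQ M'.injective_subtype M'.mkQ_surjective
        (LinearMap.exact_subtype_mkQ M'), Module.length_eq_one R (M ⧸ M'), add_mul, one_mul,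
      add_comm]

/-- The socle of a module over a local ring: the elements killed by the maximal ideal. -/
abbrev socle (R : Type u) [CommRing R] [IsLocalRing R] (X : Type u) [AddCommGroup X]
    [Module R X] : Submodule R X := Submodule.torsionBySet R X (maximalIdeal R)

/-- Restriction to the socle identifies `T X / 𝔪 T X` with `T (socle X)`, where `T` is a right
exact contravariant `Ext^d(-, N)`: the module `X / socle X` embeds into a power of `X` through
multiplication by generators of `𝔪`. -/
theorem extPullback_socle [IsNoetherianRing R] (d : ℕ)
    (h : Subsingleton (ExtMod R (ResidueField R) N (d + 1)))
    {X : Type u} [AddCommGroup X] [Module R X] (hX : IsFiniteLength R X) :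
    Function.Surjective (extPullback N (socle R X).subtype d) ∧
      LinearMap.ker (extPullback N (socle R X).subtype d) = maximalIdeal R • ⊤ := by
  have hvan {Y : Type u} [AddCommGroup Y] [Module R Y] (g : X →ₗ[R] Y)
      (hg : Function.Surjective g) : Subsingleton (ExtMod R Y N (d + 1)) :=
    subsingleton_ext_of_isFiniteLength N (d + 1) h (hX.of_surjective hg)
  have hex := LinearMap.exact_subtype_mkQ (socle R X)
  refine ⟨?_, le_antisymm ?_ ?_⟩
  · have := hvan _ (socle R X).mkQ_surjective
    exact extPullback_surjective N _ _ (socle R X).injective_subtype hex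
      (socle R X).mkQ_surjective (add_comm 1 d)
  · intro x hx
    obtain ⟨y, rfl⟩ := (ext_exact_pullback N _ _ (socle R X).injective_subtype hex
      (socle R X).mkQ_surjective d x).1 hx
    obtain ⟨n, a, ha⟩ := Submodule.fg_iff_exists_fin_generating_family.1
      (IsNoetherian.noetherian (maximalIdeal R))
    let p : X →ₗ[R] (Fin n → X) := LinearMap.pi fun i => a i • LinearMap.id
    have hker : LinearMap.ker p = socle R X := by
      ext v
      rw [LinearMap.mem_ker, Submodule.mem_torsionBySet_iff]
      constructor
      · intro hv b
        have hle : maximalIdeal R ≤ (LinearMap.toSpanSingleton R X v).ker := by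
          rw [← ha, Submodule.span_le]
          rintro _ ⟨i, rfl⟩
          exact congrFun hv i
        exact hle b.2
      · intro hv
        ext i
        exact hv ⟨a i, by
          have : a i ∈ Submodule.span R (Set.range a) := Submodule.subset_span ⟨i, rfl⟩
          rwa [ha] at this⟩
    let j : (X ⧸ socle R X) →ₗ[R] (Fin n → X) := (socle R X).liftQ p hker.ge
    have hj : Function.Injective j := by
      rw [← LinearMap.ker_eq_bot]
      exact Submodule.ker_liftQ_eq_bot _ _ _ hker.le
    have hfl : IsFiniteLength R (Fin n → X) := by
      rw [isFiniteLength_iff_isNoetherian_isArtinian] at hX ⊢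
      obtain ⟨_, _⟩ := hX
      exact ⟨inferInstance, inferInstance⟩
    have := subsingleton_ext_of_isFiniteLength N (d + 1) h
      (hfl.of_surjective (LinearMap.range j).mkQ_surjective)
    obtain ⟨z, rfl⟩ := extPullback_surjective N j (LinearMap.range j).mkQ hj
      (LinearMap.exact_map_mkQ_range j) (LinearMap.range j).mkQ_surjective (add_comm 1 d) y
    have hp : p = ∑ i, a i • LinearMap.single R (fun _ => X) i := by
      ext v i
      simp [p, LinearMap.sum_apply, Finset.sum_apply, Pi.single_apply]
    rw [← extPullback_comp, Submodule.liftQ_mkQ, hp, extPullback_sum]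
    refine Submodule.sum_mem _ fun i _ => ?_
    rw [extPullback_smul]
    refine Submodule.smul_mem_smul ?_ trivial
    rw [← ha]
    exact Submodule.subset_span ⟨i, rfl⟩
  · rw [Submodule.smul_le]
    intro r hr x _
    rw [LinearMap.mem_ker, map_smul]
    exact smul_ext_eq_zero N (fun v => Subtype.ext ((Submodule.mem_torsionBySet_iff _ _).1 v.2
      ⟨r, hr⟩)) d _

/-- For `T = Ext^d(-, N)` as in `length_ext_of_isFiniteLength`, the number of generators of `T X`
is the length of the socle of `X` times the length of `T κ`. -/
theorem length_ext_quotient [IsNoetherianRing R] (d : ℕ)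
    (h : ∀ i ≠ d, Subsingleton (ExtMod R (ResidueField R) N i))
    {X : Type u} [AddCommGroup X] [Module R X] (hX : IsFiniteLength R X) :
    Module.length R (ExtMod R X N d ⧸ (maximalIdeal R • ⊤ : Submodule R (ExtMod R X N d))) =
      Module.length R (socle R X) * Module.length R (ExtMod R (ResidueField R) N d) := by
  obtain ⟨hs, hk⟩ := extPullback_socle N d (h _ (by omega)) hX
  have hfl : IsFiniteLength R (socle R X) :=
    hX.of_injective (socle R X).injective_subtype
  rw [← length_ext_of_isFiniteLength N d h hfl, ← hk]
  exact (LinearMap.quotKerEquivOfSurjective _ hs).length_eq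

/-- The number of generators of a nonzero cyclic module is one. -/
theorem length_quotient_maximalIdeal_smul_eq_one {X : Type u} [AddCommGroup X] [Module R X]
    [Nontrivial X] {u : X} (hu : Submodule.span R {u} = ⊤) :
    Module.length R (X ⧸ (maximalIdeal R • ⊤ : Submodule R X)) = 1 := by
  have : Module.Finite R X := ⟨⟨{u}, by simpa using hu⟩⟩
  have hne : (maximalIdeal R • ⊤ : Submodule R X) ≠ ⊤ :=
    (Submodule.top_ne_ideal_smul_of_le_jacobson_annihilator (maximalIdeal_le_jacobson _)).symm
  let q := LinearMap.toSpanSingleton R (X ⧸ (maximalIdeal R • ⊤ : Submodule R X))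
    (Submodule.Quotient.mk u)
  have hq : Function.Surjective q := by
    rintro ⟨x⟩
    have hx : x ∈ Submodule.span R {u} := hu ▸ trivial
    obtain ⟨r, rfl⟩ := Submodule.mem_span_singleton.1 hx
    exact ⟨r, rfl⟩
  have hle : maximalIdeal R ≤ LinearMap.ker q := fun r hr =>
    (Submodule.Quotient.mk_eq_zero _).2 (Submodule.smul_mem_smul hr trivial)
  have hker : LinearMap.ker q = maximalIdeal R := by
    refine ((maximalIdeal.isMaximal R).eq_of_le (fun htop => hne ?_) hle).symm
    rw [LinearMap.ker_eq_top] at htop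
    rw [← Submodule.Quotient.subsingleton_iff]
    refine subsingleton_of_forall_eq 0 fun y => ?_
    obtain ⟨r, rfl⟩ := hq y
    rw [htop, LinearMap.zero_apply]
  rw [← (LinearMap.quotKerEquivOfSurjective q hq).length_eq, hker]
  exact Module.length_eq_one R (ResidueField R)

/-- Nakayama's lemma: a finite module `X` with `X / 𝔪 X` of length one is cyclic. -/
theorem exists_span_singleton_eq_top {X : Type u} [AddCommGroup X] [Module R X]
    [Module.Finite R X]
    (h : Module.length R (X ⧸ (maximalIdeal R • ⊤ : Submodule R X)) = 1) :
    ∃ u : X, Submodule.span R {u} = ⊤ := by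
  have hs : IsSimpleModule R (X ⧸ (maximalIdeal R • ⊤ : Submodule R X)) :=
    Module.length_eq_one_iff.1 h
  have := IsSimpleModule.nontrivial R (X ⧸ (maximalIdeal R • ⊤ : Submodule R X))
  obtain ⟨y, hy⟩ := exists_ne (0 : X ⧸ (maximalIdeal R • ⊤ : Submodule R X))
  obtain ⟨u, rfl⟩ := Submodule.mkQ_surjective _ y
  refine ⟨u, ?_⟩
  rw [← IsLocalRing.map_mkQ_eq_top, Submodule.map_span, Set.image_singleton]
  exact IsSimpleModule.span_singleton_eq_top R hy

/-- Let `Y` be a cyclic module of finite length with simple socle. If `Ext^i(κ, N)` vanishes for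
`i ≠ d` and has length one for `i = d`, then `Ext^d(Y, N)` is isomorphic to `Y`: it is cyclic, it
is killed by the annihilator of `Y`, and it has the same length. -/
theorem nonempty_ext_equiv_of_isFiniteLength [IsNoetherianRing R] (d : ℕ)
    (h : ∀ i ≠ d, Subsingleton (ExtMod R (ResidueField R) N i))
    (h1 : Module.length R (ExtMod R (ResidueField R) N d) = 1)
    {Y : Type u} [AddCommGroup Y] [Module R Y] (hY : IsFiniteLength R Y)
    (hs : Module.length R (socle R Y) = 1) {u : Y} (hu : Submodule.span R {u} = ⊤) :
    Nonempty (ExtMod R Y N d ≃ₗ[R] Y) := by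
  have hlen := length_ext_of_isFiniteLength N d h hY
  rw [h1, mul_one] at hlen
  have hYtop := Module.length_ne_top_iff.2 hY
  have hTfin := Module.length_ne_top_iff.1 (hlen.trans_ne hYtop)
  have : Module.Finite R (ExtMod R Y N d) := by
    obtain ⟨_, _⟩ := isFiniteLength_iff_isNoetherian_isArtinian.1 hTfin
    infer_instance
  obtain ⟨e, he⟩ := exists_span_singleton_eq_top
    ((length_ext_quotient N d h hY).trans (by rw [hs, h1, one_mul]))
  let p := LinearMap.toSpanSingleton R Y u
  let q := LinearMap.toSpanSingleton R (ExtMod R Y N d) e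
  have hp : Function.Surjective p := by
    rw [← LinearMap.range_eq_top, LinearMap.range_toSpanSingleton, hu]
  have hq : Function.Surjective q := by
    rw [← LinearMap.range_eq_top, LinearMap.range_toSpanSingleton, he]
  have hle : LinearMap.ker p ≤ LinearMap.ker q := by
    intro r hr
    refine smul_ext_eq_zero N (fun y => ?_) d e
    obtain ⟨t, rfl⟩ := hp y
    rw [← map_smul, smul_eq_mul, mul_comm, ← smul_eq_mul, map_smul]
    exact (congrArg (t • ·) (LinearMap.mem_ker.1 hr)).trans (smul_zero t)
  let g : Y →ₗ[R] ExtMod R Y N d :=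
    (LinearMap.ker p).liftQ q hle ∘ₗ (LinearMap.quotKerEquivOfSurjective p hp).symm.toLinearMap
  have hg : Function.Surjective g := by
    rw [LinearMap.coe_comp]
    refine Function.Surjective.comp ?_
      (LinearMap.quotKerEquivOfSurjective p hp).symm.surjective
    rw [← LinearMap.range_eq_top, Submodule.range_liftQ, LinearMap.range_eq_top.2 hq]
  have hker : Module.length R (LinearMap.ker g) = 0 := by
    have := Module.length_eq_add_of_exact (LinearMap.ker g).subtype g
      (Submodule.injective_subtype _) hg (LinearMap.exact_subtype_ker_map g)
    rw [hlen] at this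
    have h2 : (0 : ℕ∞) + Module.length R Y = Module.length R (LinearMap.ker g) +
      Module.length R Y := by rw [zero_add]; exact this
    exact (ENat.add_left_injective_of_ne_top hYtop h2).symm
  have hinj : Function.Injective g := by
    rw [← LinearMap.ker_eq_bot, ← Submodule.subsingleton_iff_eq_bot,
      ← Module.length_eq_zero_iff (R := R), hker]
  exact ⟨(LinearEquiv.ofBijective g ⟨hinj, hg⟩).symm⟩

end FiniteLength

/-! ### `Ext` and regular sequences -/

section RegularSequences

open IsLocalRing Pointwise RingTheory.Sequence

variable {R : Type u} [CommRing R] (N : Type u) [AddCommGroup N] [Module R N]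

theorem extPullback_lsmul {Y : Type u} [AddCommGroup Y] [Module R Y] (r : R) (i : ℕ)
    (x : ExtMod R Y N i) : extPullback N (LinearMap.lsmul R Y r) i x = r • x := by
  rw [show LinearMap.lsmul R Y r = r • LinearMap.id from rfl, extPullback_smul, extPullback_id]

/-- The connecting map of `0 → Y → Y → Y/rY → 0` identifies `Ext^{c+1}(Y/rY, N)` with
`Ext^c(Y, N) / r Ext^c(Y, N)` if `Ext^{c+1}(Y, N) = 0`. -/
theorem nonempty_ext_quotSMulTop_equiv {Y : Type u} [AddCommGroup Y] [Module R Y] {r : R}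
    (hr : IsSMulRegular Y r) (c : ℕ) [Subsingleton (ExtMod R Y N (c + 1))] :
    Nonempty (ExtMod R (QuotSMulTop r Y) N (c + 1) ≃ₗ[R] QuotSMulTop r (ExtMod R Y N c)) := by
  have hex := LinearMap.exact_lsmul_mkQ_smul_top Y r
  have hs := extConnecting_surjective N (LinearMap.lsmul R Y r) (r • (⊤ : Submodule R Y)).mkQ hr
    hex (Submodule.mkQ_surjective _) (add_comm 1 c)
  have hk := (ext_exact_pullback_connecting N (LinearMap.lsmul R Y r)
    (r • (⊤ : Submodule R Y)).mkQ hr hex (Submodule.mkQ_surjective _)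
    (add_comm 1 c)).linearMap_ker_eq
  have hrange : LinearMap.range (extPullback N (LinearMap.lsmul R Y r) c) =
      r • (⊤ : Submodule R (ExtMod R Y N c)) := by
    ext x
    simp [Submodule.mem_smul_pointwise_iff_exists, extPullback_lsmul]
  exact ⟨(LinearMap.quotKerEquivOfSurjective _ hs).symm.trans
    (Submodule.quotEquivOfEq _ _ (hk.trans hrange))⟩

/-- If `Ext^i(Y, N)` vanishes above degree `c` and `rs` is `Y`-regular of length `n`, then
`Ext^i(Y/(rs)Y, N)` vanishes above degree `c + n` and is `Ext^c(Y, N)/(rs)Ext^c(Y, N)` in that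
degree. -/
theorem ext_quotient_regular (rs : List R) : ∀ {Y : Type u} [AddCommGroup Y] [Module R Y] (c : ℕ)
    (_ : ∀ i > c, Subsingleton (ExtMod R Y N i)) (_ : IsWeaklyRegular Y rs),
    (∀ i > c + rs.length,
      Subsingleton (ExtMod R (Y ⧸ (Ideal.ofList rs • ⊤ : Submodule R Y)) N i)) ∧
    Nonempty (ExtMod R (Y ⧸ (Ideal.ofList rs • ⊤ : Submodule R Y)) N (c + rs.length) ≃ₗ[R]
      ExtMod R Y N c ⧸ (Ideal.ofList rs • ⊤ : Submodule R (ExtMod R Y N c))) := by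
  induction rs with
  | nil =>
    intro Y _ _ c h _
    have e := Submodule.quotEquivOfEqBot (Ideal.ofList ([] : List R) • ⊤ : Submodule R Y) (by simp)
    refine ⟨fun i hi => ?_, ⟨?_⟩⟩
    · have := h i (by simpa using hi)
      exact (extPullbackEquiv N e i).symm.toEquiv.subsingleton
    · exact (extPullbackEquiv N e c).symm.trans (Submodule.quotEquivOfEqBot _ (by simp)).symm
  | cons r rs ih =>
    intro Y _ _ c h hreg
    rw [isWeaklyRegular_cons_iff] at hreg
    have hs := h (c + 1) (by omega)
    have hvan : ∀ i > c + 1, Subsingleton (ExtMod R (QuotSMulTop r Y) N i) := by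
      intro i hi
      obtain ⟨i, rfl⟩ : ∃ j, i = j + 1 := ⟨i - 1, by omega⟩
      have := h i (by omega)
      have := h (i + 1) (by omega)
      have hinj := extPullback_injective N (LinearMap.lsmul R Y r)
        (r • (⊤ : Submodule R Y)).mkQ hreg.1 (LinearMap.exact_lsmul_mkQ_smul_top Y r)
        (Submodule.mkQ_surjective _) (add_comm 1 i)
      exact hinj.subsingleton
    obtain ⟨h1, ⟨h2⟩⟩ := ih (c + 1) hvan hreg.2
    have e := Submodule.quotOfListConsSMulTopEquivQuotSMulTopInner Y r rs
    have hl : c + (r :: rs).length = c + 1 + rs.length := by simp; omega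
    obtain ⟨g⟩ := nonempty_ext_quotSMulTop_equiv N hreg.1 c
    rw [hl]
    refine ⟨fun i hi => ?_, ⟨?_⟩⟩
    · have := h1 i hi
      exact (extPullbackEquiv N e i).symm.toEquiv.subsingleton
    · let g' : (ExtMod R (QuotSMulTop r Y) N (c + 1) ⧸
          (Ideal.ofList rs • ⊤ : Submodule R (ExtMod R (QuotSMulTop r Y) N (c + 1)))) ≃ₗ[R]
          QuotSMulTop r (ExtMod R Y N c) ⧸
            (Ideal.ofList rs • ⊤ : Submodule R (QuotSMulTop r (ExtMod R Y N c))) :=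
        Submodule.Quotient.equiv _ _ g (by
          rw [Submodule.map_smul'', Submodule.map_top]
          exact congrArg (Ideal.ofList rs • ·)
            (LinearMap.range_eq_top.2 g.surjective))
      exact (((extPullbackEquiv N e _).symm.trans h2).trans g').trans
        (Submodule.quotOfListConsSMulTopEquivQuotSMulTopInner (ExtMod R Y N c) r rs).symm

theorem subsingleton_ext_free (i : ℕ) (hi : 0 < i) : Subsingleton (ExtMod R R N i) := by
  obtain ⟨i, rfl⟩ : ∃ j, i = j + 1 := ⟨i - 1, by omega⟩
  exact subsingleton_ext_of_projective N i

variable [IsLocalRing R] [IsNoetherianRing R]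

/-- A quotient of a Noetherian local ring by a regular sequence as long as its dimension has finite
length. -/
theorem isFiniteLength_quotient_regular {rs : List R} (hreg : IsRegular R rs)
    (hdim : ringKrullDim R = (rs.length : WithBot ℕ∞)) :
    IsFiniteLength R (R ⧸ (Ideal.ofList rs • ⊤ : Submodule R R)) := by
  have h0 := ringKrullDim_add_length_eq_ringKrullDim_of_isRegular rs hreg
  rw [hdim] at h0
  have h1 : ringKrullDim (R ⧸ Ideal.ofList rs) ≤ 0 := by
    have : ringKrullDim (R ⧸ Ideal.ofList rs) + (rs.length : ℕ) ≤ (0 : ℕ) + (rs.length : ℕ) := by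
      simpa using h0.le
    exact (ENat.WithBot.add_le_add_natCast_right_iff).1 this
  have : Ring.KrullDimLE 0 (R ⧸ Ideal.ofList rs) :=
    (Order.krullDimLE_iff _ _).2 (by exact_mod_cast h1)
  have : IsArtinianRing (R ⧸ Ideal.ofList rs) := IsNoetherianRing.isArtinianRing_of_krullDimLE_zero
  have : IsArtinian R (R ⧸ Ideal.ofList rs) :=
    isArtinian_of_surjective_algebraMap (S := R) (R := R ⧸ Ideal.ofList rs)
      Ideal.Quotient.mk_surjective
  have hfl : IsFiniteLength R (R ⧸ Ideal.ofList rs) :=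
    isFiniteLength_iff_isNoetherian_isArtinian.2 ⟨inferInstance, inferInstance⟩
  exact (Submodule.quotEquivOfEq _ _ (by simp)).isFiniteLength hfl

/-- Over a Cohen-Macaulay local ring of dimension `d`, a module of finite injective dimension has
`Ext^i(κ, N) = 0` for `i > d`: a quotient of the ring by a maximal regular sequence contains `κ`
and has projective dimension `d`. -/
theorem subsingleton_ext_residueField_of_lt {rs : List R} (hreg : IsRegular R rs)
    (hdim : ringKrullDim R = (rs.length : WithBot ℕ∞)) (hN : HasFiniteInjectiveDimension R N)
    {i : ℕ} (hi : rs.length < i) : Subsingleton (ExtMod R (ResidueField R) N i) := by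
  have hX := isFiniteLength_quotient_regular hreg hdim
  obtain ⟨_, hart⟩ := isFiniteLength_iff_isNoetherian_isArtinian.1 hX
  have := hreg.quot_ofList_smul_nontrivial ⊤
  obtain ⟨P, hP, -⟩ := (eq_bot_or_exists_atom_le
    (⊤ : Submodule R (R ⧸ (Ideal.ofList rs • ⊤ : Submodule R R)))).resolve_left top_ne_bot
  have : IsSimpleModule R P := isSimpleModule_iff_isAtom.2 hP
  obtain ⟨e⟩ := nonempty_linearEquiv_residueField (R := R) P
  obtain ⟨n, hn⟩ := hN
  suffices ∀ t i : ℕ, rs.length < i → n ≤ i + t →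
      Subsingleton (ExtMod R (ResidueField R) N i) from this n i hi (by omega)
  intro t
  induction t with
  | zero => exact fun i _ h => HasInjectiveDimensionLT.subsingleton.{u} (ModuleCat.of R N) n i h _
  | succ t ih =>
    intro i hi ht
    have hq := subsingleton_ext_of_isFiniteLength N (i + 1) (ih (i + 1) (by omega) (by omega))
      (hX.of_surjective P.mkQ_surjective)
    have h0 := (ext_quotient_regular N rs (Y := R) 0 (subsingleton_ext_free N)
      hreg.toIsWeaklyRegular).1 i (by omega)
    have hs := extPullback_surjective N P.subtype P.mkQ P.injective_subtype
      (LinearMap.exact_subtype_mkQ P) P.mkQ_surjective (add_comm 1 i)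
    have := hs.subsingleton
    exact (extPullbackEquiv N e i).toEquiv.subsingleton

/-- The easy direction of Rees' theorem. -/
theorem subsingleton_ext_residueField_of_isMaximalCohenMacaulay (hN : IsMaximalCohenMacaulay R N)
    {d : ℕ} (hd : ringKrullDim R = (d : WithBot ℕ∞)) {i : ℕ} (hi : i < d) :
    Subsingleton (ExtMod R (ResidueField R) N i) := by
  obtain ⟨_, rs, hmem, hreg, hlen⟩ := hN
  have : d = rs.length := by
    rw [hd] at hlen
    exact_mod_cast hlen
  subst this
  have := hreg.nontrivial
  have hsupp : Module.support R (ResidueField R) ⊆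
      PrimeSpectrum.zeroLocus (maximalIdeal R : Set R) := by
    rw [Module.support_eq_zeroLocus]
    refine PrimeSpectrum.zeroLocus_anti_mono ?_
    exact (Ideal.annihilator_quotient (I := maximalIdeal R)).ge
  exact ModuleCat.subsingleton_ext_of_exists_isRegular (maximalIdeal R)
    (ModuleCat.of R (ResidueField R)) hsupp (ModuleCat.of R N)
    (lt_top_iff_ne_top.2 (Submodule.top_ne_ideal_smul_of_le_jacobson_annihilator
      (maximalIdeal_le_jacobson _)).symm) rs hmem hreg i hi

/-- A maximal Cohen-Macaulay module of finite injective dimension over a Cohen-Macaulay local ring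
of dimension `d` has `Ext^i(κ, N) = 0` for `i ≠ d`. -/
theorem subsingleton_ext_residueField (hR : IsMaximalCohenMacaulay R R)
    (hN : IsMaximalCohenMacaulay R N) (hinj : HasFiniteInjectiveDimension R N)
    {d : ℕ} (hd : ringKrullDim R = (d : WithBot ℕ∞)) (i : ℕ) (hi : i ≠ d) :
    Subsingleton (ExtMod R (ResidueField R) N i) := by
  rcases lt_or_gt_of_ne hi with hi | hi
  · exact subsingleton_ext_residueField_of_isMaximalCohenMacaulay N hN hd hi
  · obtain ⟨_, rs, hmem, hreg, hlen⟩ := hR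
    have : d = rs.length := by
      rw [hd] at hlen
      exact_mod_cast hlen
    subst this
    exact subsingleton_ext_residueField_of_lt N hreg hlen hinj hi

/-- A Gorenstein local ring `R` of dimension `d` has type one, and a quotient of `R` by a maximal
regular sequence has a simple socle. Indeed `T = Ext^d(-, R)` satisfies `T (R/(rs)) = R/(rs)`, which
has one generator, so that `length (socle (R/(rs))) * length (T κ) = 1`. -/
theorem length_socle_mul_length_ext_eq_one (hR : IsMaximalCohenMacaulay R R)
    (hinj : HasFiniteInjectiveDimension R R) {rs : List R} (hreg : IsRegular R rs)
    (hdim : ringKrullDim R = (rs.length : WithBot ℕ∞)) :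
    Module.length R (socle R (R ⧸ (Ideal.ofList rs • ⊤ : Submodule R R))) = 1 ∧
      Module.length R (ExtMod R (ResidueField R) R rs.length) = 1 := by
  have hX := isFiniteLength_quotient_regular hreg hdim
  have hT := length_ext_quotient R rs.length
    (subsingleton_ext_residueField R hR hR hinj hdim) hX
  obtain ⟨g⟩ := (ext_quotient_regular R rs (Y := R) 0 (subsingleton_ext_free R)
      hreg.toIsWeaklyRegular).2
  rw [zero_add] at g
  let e0 : ExtMod R R R 0 ≃ₗ[R] R := (extZeroEquiv R).trans (LinearMap.ringLmapEquivSelf R R R)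
  let e : ExtMod R (R ⧸ (Ideal.ofList rs • ⊤ : Submodule R R)) R rs.length ≃ₗ[R]
      R ⧸ (Ideal.ofList rs • ⊤ : Submodule R R) := g.trans (Submodule.Quotient.equiv _ _ e0 (by
    rw [Submodule.map_smul'', Submodule.map_top, LinearMap.range_eq_top.2 e0.surjective]))
  have := hreg.quot_ofList_smul_nontrivial ⊤
  have := e.toEquiv.nontrivial
  have hgen : Submodule.span R {e.symm (Submodule.Quotient.mk 1)} = ⊤ := by
    rw [eq_top_iff]
    intro x _
    obtain ⟨r, hr⟩ := Submodule.Quotient.mk_surjective _ (e x)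
    refine Submodule.mem_span_singleton.2 ⟨r, ?_⟩
    apply e.injective
    rw [map_smul, e.apply_symm_apply, ← hr]
    exact (Submodule.Quotient.mk_smul _ _ _).symm.trans (congrArg _ (mul_one r))
  rw [length_quotient_maximalIdeal_smul_eq_one hgen] at hT
  exact _root_.mul_eq_one.1 hT.symm

end RegularSequences

/-! ### Going up along a regular sequence -/

section Dual

open IsLocalRing Pointwise RingTheory.Sequence

variable {R : Type u} [CommRing R] [IsLocalRing R]

theorem length_socle_congr {X Y : Type u}
    [AddCommGroup X] [Module R X] [AddCommGroup Y] [Module R Y] (e : X ≃ₗ[R] Y) :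
    Module.length R (socle R X) = Module.length R (socle R Y) := by
  have h : (socle R X).map e.toLinearMap = socle R Y := by
    ext y
    obtain ⟨x, rfl⟩ := e.surjective y
    simp only [Submodule.mem_map_equiv, Submodule.mem_torsionBySet_iff, e.symm_apply_apply,
      ← map_smul, LinearEquiv.map_eq_zero_iff]
  exact ((e.submoduleMap _).trans (LinearEquiv.ofEq _ _ h)).length_eq

/-- Nakayama's lemma: a finite module `X` with `r X = X` for some `r` in the maximal ideal is
zero. -/
theorem subsingleton_of_smul_surjective {X : Type u} [AddCommGroup X] [Module R X]
    [Module.Finite R X] {r : R} (hr : r ∈ maximalIdeal R) (h : ∀ x : X, ∃ y : X, r • y = x) :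
    Subsingleton X := by
  by_contra hX
  rw [not_subsingleton_iff_nontrivial] at hX
  refine Submodule.top_ne_pointwise_smul_of_mem_jacobson_annihilator (M := X)
    (maximalIdeal_le_jacobson _ hr) (eq_top_iff.2 fun x _ => ?_).symm
  obtain ⟨y, rfl⟩ := h x
  exact Submodule.smul_mem_pointwise_smul y r ⊤ trivial

variable [IsNoetherianRing R]

/-- Let `Y` be cyclic and `E` finite and killed by the annihilator of `Y`. If `r` in the maximal
ideal is `E`-regular and `E/rE ≃ Y/rY`, then `E ≃ Y`. By Nakayama's lemma, `E` is cyclic, and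
the annihilators `a` of `Y` and `b` of `E` satisfy `b = a + r b`. -/
theorem nonempty_equiv_of_quotSMulTop {Y E : Type u} [AddCommGroup Y] [Module R Y]
    [AddCommGroup E] [Module R E] [Module.Finite R E] {r : R} (hr : r ∈ maximalIdeal R)
    (hreg : IsSMulRegular E r) {u : Y} (hu : Submodule.span R {u} = ⊤)
    (hann : ∀ s : R, (∀ y : Y, s • y = 0) → ∀ x : E, s • x = 0)
    (ε : QuotSMulTop r E ≃ₗ[R] QuotSMulTop r Y) : Nonempty (E ≃ₗ[R] Y) := by
  obtain ⟨e, he⟩ := Submodule.Quotient.mk_surjective _ (ε.symm (Submodule.Quotient.mk u))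
  have hjac : Ideal.span {r} ≤ Ideal.jacobson (⊥ : Ideal R) :=
    (Ideal.span_singleton_le_iff_mem _).2 (maximalIdeal_le_jacobson _ hr)
  have hspan : Submodule.span R {e} = ⊤ := by
    rw [eq_top_iff]
    refine Submodule.le_of_le_smul_of_le_jacobson_bot Module.Finite.fg_top hjac ?_
    intro x _
    obtain ⟨y, hy⟩ := Submodule.Quotient.mk_surjective _ (ε (Submodule.Quotient.mk x))
    obtain ⟨t, rfl⟩ := Submodule.mem_span_singleton.1
      (show y ∈ Submodule.span R {u} from hu ▸ trivial)
    have hx : (Submodule.Quotient.mk x : QuotSMulTop r E) = Submodule.Quotient.mk (t • e) := by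
      apply ε.injective
      rw [← hy, Submodule.Quotient.mk_smul, Submodule.Quotient.mk_smul, map_smul, he,
        ε.apply_symm_apply]
    rw [Submodule.Quotient.eq] at hx
    rw [Submodule.ideal_span_singleton_smul, show x = t • e + (x - t • e) by abel]
    exact Submodule.add_mem_sup (Submodule.smul_mem _ t (Submodule.mem_span_singleton_self e)) hx
  let p := LinearMap.toSpanSingleton R Y u
  let q := LinearMap.toSpanSingleton R E e
  have hp : Function.Surjective p := by
    rw [← LinearMap.range_eq_top, LinearMap.range_toSpanSingleton, hu]
  have hq : Function.Surjective q := by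
    rw [← LinearMap.range_eq_top, LinearMap.range_toSpanSingleton, hspan]
  have hle : LinearMap.ker p ≤ LinearMap.ker q := by
    intro s hs
    refine hann s (fun y => ?_) e
    obtain ⟨t, rfl⟩ := hp y
    rw [← map_smul, smul_eq_mul, mul_comm, ← smul_eq_mul, map_smul]
    exact (congrArg (t • ·) (LinearMap.mem_ker.1 hs)).trans (smul_zero t)
  have hge : LinearMap.ker q ≤ LinearMap.ker p := by
    refine Submodule.le_of_le_smul_of_le_jacobson_bot (IsNoetherian.noetherian _) hjac ?_
    intro z hz
    have hze : z • e = 0 := hz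
    have hzu : z • u ∈ r • (⊤ : Submodule R Y) := by
      rw [← Submodule.Quotient.mk_eq_zero, Submodule.Quotient.mk_smul]
      apply ε.symm.injective
      rw [map_smul, ← he, ← Submodule.Quotient.mk_smul, hze, Submodule.Quotient.mk_zero, map_zero]
    obtain ⟨y, -, hy⟩ := (Submodule.mem_smul_pointwise_iff_exists _ _ _).1 hzu
    obtain ⟨t, rfl⟩ := Submodule.mem_span_singleton.1
      (show y ∈ Submodule.span R {u} from hu ▸ trivial)
    have h1 : z - r * t ∈ LinearMap.ker p := by
      change (z - r * t) • u = 0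
      rw [sub_smul, mul_smul, hy, sub_self]
    have h2 : t ∈ LinearMap.ker q := by
      have h3 : (z - r * t) • e = 0 := hle h1
      rw [sub_smul, hze, zero_sub, neg_eq_zero, mul_smul] at h3
      exact hreg (h3.trans (smul_zero r).symm)
    rw [Submodule.ideal_span_singleton_smul, show z = (z - r * t) + r • t by simp]
    exact Submodule.add_mem_sup h1 (Submodule.smul_mem_pointwise_smul t r _ h2)
  exact ⟨(LinearMap.quotKerEquivOfSurjective q hq).symm.trans
    ((Submodule.quotEquivOfEq _ _ (le_antisymm hge hle)).trans
      (LinearMap.quotKerEquivOfSurjective p hp))⟩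

variable (N : Type u) [AddCommGroup N] [Module R N] [Module.Finite R N]

/-- The induction step of `ext_equiv_of_regular`: multiplication by `r` is surjective on
`Ext^i(Y, N)` for `i ≠ c` and injective for `i = c`, because the neighbouring `Ext(Y/rY, N)`
vanish. -/
theorem ext_equiv_of_quotSMulTop {Y : Type u} [AddCommGroup Y] [Module R Y] {u : Y}
    (hu : Submodule.span R {u} = ⊤) {r : R} (hr : r ∈ maximalIdeal R) (hreg : IsSMulRegular Y r)
    (c : ℕ) (h : ∀ i ≠ c + 1, Subsingleton (ExtMod R (QuotSMulTop r Y) N i))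
    (e : ExtMod R (QuotSMulTop r Y) N (c + 1) ≃ₗ[R] QuotSMulTop r Y) :
    (∀ i ≠ c, Subsingleton (ExtMod R Y N i)) ∧ Nonempty (ExtMod R Y N c ≃ₗ[R] Y) := by
  have : Module.Finite R Y := ⟨⟨{u}, by simpa using hu⟩⟩
  have hfin (i : ℕ) : Module.Finite R (ExtMod R Y N i) :=
    ModuleCat.finite_ext R (ModuleCat.of R Y) (ModuleCat.of R N) i
  have hex := LinearMap.exact_lsmul_mkQ_smul_top Y r
  have hvan (i : ℕ) (hi : i ≠ c) : Subsingleton (ExtMod R Y N i) := by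
    refine subsingleton_of_smul_surjective hr fun x => ?_
    have := h (i + 1) (by omega)
    obtain ⟨y, rfl⟩ := extPullback_surjective N (LinearMap.lsmul R Y r) _ hreg hex
      (Submodule.mkQ_surjective _) (add_comm 1 i) x
    exact ⟨y, (extPullback_lsmul N r i y).symm⟩
  refine ⟨hvan, ?_⟩
  have := hvan (c + 1) (by omega)
  obtain ⟨g⟩ := nonempty_ext_quotSMulTop_equiv N hreg c
  refine nonempty_equiv_of_quotSMulTop hr ?_ hu (fun s hs x => smul_ext_eq_zero N hs c x)
    (g.symm.trans e)
  rw [isSMulRegular_iff_right_eq_zero_of_smul]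
  intro x hx
  rw [← extPullback_lsmul] at hx
  obtain ⟨y, rfl⟩ := (ext_exact_pullback N (LinearMap.lsmul R Y r) _ hreg hex
    (Submodule.mkQ_surjective _) c x).1 hx
  have := h c (by omega)
  rw [Subsingleton.elim y 0, map_zero]

/-- Let `Y` be a cyclic module with a regular sequence `rs` of length `d - c` such that `Y/(rs)Y`
has finite length and a simple socle. If `Ext^i(κ, N)` vanishes for `i ≠ d` and has length one for
`i = d`, then `Ext^i(Y, N)` vanishes for `i ≠ c` and is isomorphic to `Y` for `i = c`. -/
theorem ext_equiv_of_regular {d : ℕ}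
    (h : ∀ i ≠ d, Subsingleton (ExtMod R (ResidueField R) N i))
    (h1 : Module.length R (ExtMod R (ResidueField R) N d) = 1) (rs : List R) :
    ∀ {Y : Type u} [AddCommGroup Y] [Module R Y] {u : Y} (_ : Submodule.span R {u} = ⊤) (c : ℕ)
      (_ : c + rs.length = d) (_ : ∀ r ∈ rs, r ∈ maximalIdeal R) (_ : IsWeaklyRegular Y rs)
      (_ : IsFiniteLength R (Y ⧸ (Ideal.ofList rs • ⊤ : Submodule R Y)))
      (_ : Module.length R (socle R (Y ⧸ (Ideal.ofList rs • ⊤ : Submodule R Y))) = 1),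
      (∀ i ≠ c, Subsingleton (ExtMod R Y N i)) ∧ Nonempty (ExtMod R Y N c ≃ₗ[R] Y) := by
  induction rs with
  | nil =>
    intro Y _ _ u hu c hc _ _ hfl hs
    have e := Submodule.quotEquivOfEqBot (Ideal.ofList ([] : List R) • ⊤ : Submodule R Y) (by simp)
    have hY := e.isFiniteLength hfl
    obtain rfl : c = d := by simpa using hc
    exact ⟨fun i hi => subsingleton_ext_of_isFiniteLength N i (h i hi) hY,
      nonempty_ext_equiv_of_isFiniteLength N c h h1 hY ((length_socle_congr e).symm.trans hs) hu⟩
  | cons r rs ih =>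
    intro Y _ _ u hu c hc hmem hreg hfl hs
    rw [isWeaklyRegular_cons_iff] at hreg
    have e := Submodule.quotOfListConsSMulTopEquivQuotSMulTopInner Y r rs
    have hu' : Submodule.span R {(Submodule.Quotient.mk u : QuotSMulTop r Y)} = ⊤ := by
      have := congrArg (Submodule.map (r • (⊤ : Submodule R Y)).mkQ) hu
      rwa [Submodule.map_span, Set.image_singleton, Submodule.map_top, Submodule.range_mkQ] at this
    obtain ⟨h2, ⟨g⟩⟩ := ih hu' (c + 1) (by simp at hc; omega)
      (fun s hs => hmem s (List.mem_cons_of_mem r hs)) hreg.2 (e.isFiniteLength hfl)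
      ((length_socle_congr e).symm.trans hs)
    exact ext_equiv_of_quotSMulTop N hu (hmem r List.mem_cons_self) hreg.1 c h2 g

end Dual

/-! ### Height and dimension -/

section Height

open IsLocalRing RingTheory.Sequence

variable {R : Type u} [CommRing R] [IsNoetherianRing R]

/-- An ideal contains no regular sequence longer than its height. -/
theorem length_le_height {I : Ideal R} {rs : List R} (hmem : ∀ r ∈ rs, r ∈ I)
    (hreg : IsWeaklyRegular R rs) : (rs.length : ℕ∞) ≤ I.height := by
  rw [Ideal.height_eq_inf_minimalPrimes]
  refine le_iInf₂ fun p hp => ?_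
  have := hp.isPrime
  have hreg' := hreg.isRegular_of_isLocalization_of_mem (Localization.AtPrime p) p
    (fun r hr => hp.1.2 (hmem r hr))
  have hdim := ringKrullDim_add_length_eq_ringKrullDim_of_isRegular _ hreg'
  rw [IsLocalization.AtPrime.ringKrullDim_eq_height p (Localization.AtPrime p), List.length_map]
    at hdim
  have hnt : Nontrivial (Localization.AtPrime p ⧸
      Ideal.ofList (rs.map (algebraMap R (Localization.AtPrime p)))) := by
    rw [Ideal.Quotient.nontrivial_iff]
    intro htop
    exact hreg'.top_ne_smul (by rw [htop]; simp)
  have h0 := ringKrullDim_nonneg_of_nontrivial (R := Localization.AtPrime p ⧸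
      Ideal.ofList (rs.map (algebraMap R (Localization.AtPrime p))))
  have h2 : ((rs.length : ℕ∞) : WithBot ℕ∞) ≤ (p.height : WithBot ℕ∞) := by
    rw [← hdim]
    exact le_add_of_nonneg_left h0
  exact_mod_cast h2

/-- `ht I + dim R/I ≤ dim R`. -/
theorem height_add_ringKrullDim_quotient_le {R : Type u} [CommRing R] {I : Ideal R} {k e : ℕ}
    (hI : I.height = (k : ℕ∞)) (he : ringKrullDim (R ⧸ I) = (e : WithBot ℕ∞)) :
    ((k + e : ℕ) : WithBot ℕ∞) ≤ ringKrullDim R := by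
  rw [ringKrullDim_quotient] at he
  obtain ⟨p, hp⟩ := Order.le_krullDim_iff.1 he.ge
  let q : PrimeSpectrum R := p.head
  have hq : I ≤ q.asIdeal := p.head.2
  have h1 : (k : ℕ∞) ≤ Order.height q := by
    rw [← hI]
    exact (Ideal.height_mono hq).trans_eq (PrimeSpectrum.height_eq_orderHeight q)
  have h2 : (e : ℕ∞) ≤ Order.coheight q := by
    have := Order.length_le_coheight_head
      (p := p.map (Subtype.val : PrimeSpectrum.zeroLocus (R := R) I → _) (fun _ _ h => h))
    rw [← hp]
    exact this
  have : Nonempty (PrimeSpectrum R) := ⟨q⟩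
  rw [ringKrullDim, Order.krullDim_eq_iSup_height_add_coheight_of_nonempty]
  have h3 : ((k + e : ℕ) : ℕ∞) ≤ ⨆ a : PrimeSpectrum R, Order.height a + Order.coheight a := by
    push_cast
    exact (add_le_add h1 h2).trans
      (le_iSup (fun a : PrimeSpectrum R => Order.height a + Order.coheight a) q)
  exact_mod_cast h3

end Height

/-! ### Canonical modules and quotients of Gorenstein local rings -/

section CanonicalModules

open IsLocalRing RingTheory.Sequence

variable {R : Type u} [CommRing R] [IsLocalRing R]

/-- Over a Cohen-Macaulay local ring of dimension `d`, a canonical module `ω` has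
`Ext^i(κ, ω) = 0` for `i ≠ d`, and `Ext^d(κ, ω)` has length one. -/
theorem IsCanonicalModule.ext_residueField (hR : IsCohenMacaulayLocalRing R) {ω : Type u}
    [AddCommGroup ω] [Module R ω] (hω : IsCanonicalModule R ω) {d : ℕ}
    (hd : ringKrullDim R = (d : WithBot ℕ∞)) :
    (∀ i ≠ d, Subsingleton (ExtMod R (ResidueField R) ω i)) ∧
      Module.length R (ExtMod R (ResidueField R) ω d) = 1 := by
  have := hR.toIsNoetherian
  refine ⟨subsingleton_ext_residueField ω hR.maximalCohenMacaulay hω.maximalCohenMacaulay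
    hω.finite_injectiveDimension hd, ?_⟩
  obtain ⟨d', hd', ⟨e⟩⟩ := hω.type_one
  obtain rfl : d = d' := by
    rw [hd] at hd'
    exact_mod_cast hd'
  rw [e.length_eq]
  exact Module.length_eq_one R (ResidueField R)

/-- A canonical module of a Gorenstein local ring is free of rank one. -/
theorem IsCanonicalModule.nonempty_equiv (hR : IsCohenMacaulayLocalRing R)
    (hR' : IsGorensteinLocalRing R) {ω : Type u}
    [AddCommGroup ω] [Module R ω] (hω : IsCanonicalModule R ω) : Nonempty (ω ≃ₗ[R] R) := by
  have := hR.toIsNoetherian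
  have := hω.maximalCohenMacaulay.finite
  obtain ⟨rs, hmem, hreg, hdim⟩ := hR.maximalCohenMacaulay.exists_regular
  obtain ⟨h, h1⟩ := hω.ext_residueField hR hdim
  have hsoc := (length_socle_mul_length_ext_eq_one hR.maximalCohenMacaulay
    hR'.finite_injectiveDimension hreg hdim).1
  obtain ⟨-, ⟨e⟩⟩ := ext_equiv_of_regular ω h h1 rs (Y := R) (u := 1)
    (Ideal.span_singleton_one) 0 (zero_add _) hmem hreg.toIsWeaklyRegular
    (isFiniteLength_quotient_regular hreg hdim) hsoc
  exact ⟨((extZeroEquiv ω).trans (LinearMap.ringLmapEquivSelf R R ω)).symm.trans e⟩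

/-- The socle over a local quotient ring. -/
theorem length_socle_of_surjective {S : Type u} [CommRing S] [IsLocalRing S] [Algebra R S]
    (hS : Function.Surjective (algebraMap R S)) (X : Type u) [AddCommGroup X] [Module R X]
    [Module S X] [IsScalarTower R S X] :
    Module.length R (socle R X) = Module.length S (socle S X) := by
  have : IsLocalHom (algebraMap R S) := hS.isLocalHom _
  have h : (socle S X).restrictScalars R = socle R X := by
    ext x
    rw [Submodule.restrictScalars_mem, Submodule.mem_torsionBySet_iff,
      Submodule.mem_torsionBySet_iff]
    constructor
    · rintro hx ⟨r, hr⟩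
      have := hx ⟨algebraMap R S r, map_nonunit (algebraMap R S) r hr⟩
      rwa [Subtype.coe_mk, algebraMap_smul] at this
    · rintro hx ⟨s, hs⟩
      obtain ⟨r, rfl⟩ := hS s
      have := hx ⟨r, fun hu => hs (hu.map _)⟩
      simpa using this
  rw [← h, ← Module.length_eq_of_surjective (R := S) (S := R) (M := socle S X) hS]
  rfl

/-- For `R` and `R/I` Gorenstein local and `I` of height `k`, `Ext^i(R/I, R)` vanishes for `i ≠ k`
and is isomorphic to `R/I` for `i = k`. -/
theorem ext_quotient_ideal (hR : IsCohenMacaulayLocalRing R)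
    (hR' : IsGorensteinLocalRing R) {I : Ideal R} {k : ℕ} (hI : I.height = (k : ℕ∞))
    (hRI : IsCohenMacaulayLocalRing (R ⧸ I)) (hRI' : IsGorensteinLocalRing (R ⧸ I)) :
    (∀ i ≠ k, Subsingleton (ExtMod R (R ⧸ I) R i)) ∧
      Nonempty (ExtMod R (R ⧸ I) R k ≃ₗ[R] R ⧸ I) := by
  have := hR.toIsNoetherian
  have := hRI.toIsLocalRing
  have hsurj : Function.Surjective (algebraMap R (R ⧸ I)) := Ideal.Quotient.mk_surjective
  obtain ⟨xs, -, hxreg, hxdim⟩ := hR.maximalCohenMacaulay.exists_regular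
  obtain ⟨ys, hymem, hyreg, hydim⟩ := hRI.maximalCohenMacaulay.exists_regular
  have h := subsingleton_ext_residueField R hR.maximalCohenMacaulay hR.maximalCohenMacaulay
    hR'.finite_injectiveDimension hxdim
  have h1 := (length_socle_mul_length_ext_eq_one hR.maximalCohenMacaulay
    hR'.finite_injectiveDimension hxreg hxdim).2
  have hsoc := (length_socle_mul_length_ext_eq_one hRI.maximalCohenMacaulay
    hRI'.finite_injectiveDimension hyreg hydim).1
  have hfl := isFiniteLength_quotient_regular hyreg hydim
  obtain ⟨rs, rfl⟩ := hsurj.list_map ys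
  have hke := height_add_ringKrullDim_quotient_le hI hydim
  rw [hxdim, List.length_map] at hke
  replace hke : k + rs.length ≤ xs.length := by exact_mod_cast hke
  have heq : (Ideal.ofList (rs.map (algebraMap R (R ⧸ I))) •
      (⊤ : Submodule (R ⧸ I) (R ⧸ I))).restrictScalars R = Ideal.ofList rs • ⊤ := by
    rw [← Ideal.map_ofList, Ideal.smul_restrictScalars, Submodule.restrictScalars_top]
  let ε : ((R ⧸ I) ⧸ (Ideal.ofList rs • ⊤ : Submodule R (R ⧸ I))) ≃ₗ[R]
      (R ⧸ I) ⧸ (Ideal.ofList (rs.map (algebraMap R (R ⧸ I))) •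
        (⊤ : Submodule (R ⧸ I) (R ⧸ I))) :=
    (Submodule.quotEquivOfEq _ _ heq.symm).trans (Submodule.Quotient.restrictScalarsEquiv R _)
  have hmem : ∀ r ∈ rs, r ∈ maximalIdeal R := fun r hr => by
    have h2 := hymem _ (List.mem_map_of_mem hr)
    rw [mem_maximalIdeal, mem_nonunits_iff] at h2 ⊢
    exact fun hu => h2 (hu.map _)
  have hfl' : IsFiniteLength R ((R ⧸ I) ⧸ (Ideal.ofList rs • ⊤ : Submodule R (R ⧸ I))) := by
    rw [← Module.length_ne_top_iff, ε.length_eq, Module.length_eq_of_surjective hsurj]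
    exact Module.length_ne_top_iff.2 hfl
  have hsoc' : Module.length R
      (socle R ((R ⧸ I) ⧸ (Ideal.ofList rs • ⊤ : Submodule R (R ⧸ I)))) = 1 := by
    rw [length_socle_congr ε, length_socle_of_surjective hsurj, hsoc]
  obtain ⟨hvan, hiso⟩ := ext_equiv_of_regular R h h1 rs (Y := R ⧸ I) (u := 1) (by
      rw [eq_top_iff]
      intro x _
      obtain ⟨r, rfl⟩ := Ideal.Quotient.mk_surjective x
      exact Submodule.mem_span_singleton.2 ⟨r, by simp [Algebra.smul_def]⟩)
    (xs.length - rs.length) (by omega) hmem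
    ((isWeaklyRegular_map_algebraMap_iff (R ⧸ I) (R ⧸ I) rs).1 hyreg.toIsWeaklyRegular) hfl' hsoc'
  -- By Rees' theorem, the vanishing of `Ext` bounds the height of `I` from below.
  have hck : xs.length - rs.length ≤ k := by
    have hlt : I • (⊤ : Submodule R R) < ⊤ := by
      rw [smul_eq_mul, Ideal.mul_top, lt_top_iff_ne_top]
      exact Ideal.Quotient.nontrivial_iff.1 inferInstance
    obtain ⟨zs, hlen, hzmem, hzreg⟩ := ModuleCat.exists_isRegular_of_exists_subsingleton_ext I
      (xs.length - rs.length) (ModuleCat.of R R) hlt (ModuleCat.of R (R ⧸ I))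
      (by
        rw [Module.support_eq_zeroLocus]
        exact congrArg _ (congrArg _ Ideal.annihilator_quotient))
      (fun i hi => hvan i (by omega))
    have := length_le_height hzmem hzreg.toIsWeaklyRegular
    rw [hI, hlen] at this
    exact_mod_cast this
  obtain rfl : xs.length - rs.length = k := by omega
  exact ⟨hvan, hiso⟩

end CanonicalModules

/-! ### Modules killed by `I` -/

section Orbits

variable {R : Type u} [CommRing R] {I : Ideal R} (C : Type u) [AddCommGroup C] [Module R C]

/-- For an element `x` of a module killed by `I`, the map `R/I → X`, `r ↦ r x`. -/
def quotientOrbit {X : Type u} [AddCommGroup X] [Module R X] (hX : ∀ r ∈ I, ∀ x : X, r • x = 0)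
    (x : X) : (R ⧸ I) →ₗ[R] X :=
  Submodule.liftQ I (LinearMap.toSpanSingleton R X x) (fun r hr => hX r hr x)

theorem quotient_hom_ext {X : Type u} [AddCommGroup X] [Module R X] {f g : (R ⧸ I) →ₗ[R] X}
    (h : f 1 = g 1) : f = g :=
  Submodule.linearMap_qext _ (LinearMap.ext_ring h)

theorem quotient_mk_eq_smul_one (r : R) :
    (Submodule.Quotient.mk r : R ⧸ I) = r • (1 : R ⧸ I) := by
  rw [← map_one (Ideal.Quotient.mk I), ← Ideal.Quotient.mk_eq_mk, ← Submodule.Quotient.mk_smul,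
    smul_eq_mul, mul_one]

@[simp]
theorem quotientOrbit_one {X : Type u} [AddCommGroup X] [Module R X]
    (hX : ∀ r ∈ I, ∀ x : X, r • x = 0) (x : X) : quotientOrbit hX x 1 = x :=
  one_smul R x

theorem quotientOrbit_comp {X Y : Type u} [AddCommGroup X] [Module R X] [AddCommGroup Y]
    [Module R Y] (hX : ∀ r ∈ I, ∀ x : X, r • x = 0) (hY : ∀ r ∈ I, ∀ y : Y, r • y = 0)
    (g : X →ₗ[R] Y) (x : X) : g ∘ₗ quotientOrbit hX x = quotientOrbit hY (g x) :=
  quotient_hom_ext (by simp)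

theorem quotientOrbit_smul_one (hI : ∀ r ∈ I, ∀ x : R ⧸ I, r • x = 0) (r : R) :
    quotientOrbit hI (r • (1 : R ⧸ I)) = r • LinearMap.id :=
  quotient_hom_ext (by simp)

/-- For `X` killed by `I`, the map `Ext^k(X, C) → Hom(X, Ext^k(R/I, C))` sending `η` to
`x ↦ (r ↦ r x)^* η`. -/
noncomputable def extOrbit {X : Type u} [AddCommGroup X] [Module R X]
    (hX : ∀ r ∈ I, ∀ x : X, r • x = 0) (k : ℕ) :
    ExtMod R X C k →ₗ[R] (X →ₗ[R] ExtMod R (R ⧸ I) C k) :=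
  LinearMap.mk₂ R (fun η x => extPullback C (quotientOrbit hX x) k η)
    (fun η η' x => map_add _ η η') (fun r η x => map_smul _ r η)
    (fun η x y => by
      rw [← extPullback_add, show quotientOrbit hX (x + y) = quotientOrbit hX x + quotientOrbit hX y
        from quotient_hom_ext (by simp)])
    (fun r η x => by
      rw [← extPullback_smul, show quotientOrbit hX (r • x) = r • quotientOrbit hX x
        from quotient_hom_ext (by simp)])

@[simp]
theorem extOrbit_apply {X : Type u} [AddCommGroup X] [Module R X]
    (hX : ∀ r ∈ I, ∀ x : X, r • x = 0) (k : ℕ) (η : ExtMod R X C k) (x : X) :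
    extOrbit C hX k η x = extPullback C (quotientOrbit hX x) k η := rfl

/-- If the identity of `X` is a sum of maps that factor through `S`, then an element of
`Ext^j(X, C)` is determined by its restrictions to `S`. -/
theorem ext_eq_zero_of_sum_comp_eq_id {S X : Type u} [AddCommGroup S] [Module R S]
    [AddCommGroup X] [Module R X] {ι : Type*} [Fintype ι] (f : ι → X →ₗ[R] S) (g : ι → S →ₗ[R] X)
    (h : ∑ i, g i ∘ₗ f i = LinearMap.id) (j : ℕ) (η : ExtMod R X C j)
    (hη : ∀ i, extPullback C (g i) j η = 0) : η = 0 := by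
  rw [← extPullback_id C j η, ← h, extPullback_sum]
  exact Finset.sum_eq_zero fun i _ => by rw [extPullback_comp, hη, map_zero]

theorem subsingleton_ext_of_sum_comp_eq_id {S X : Type u} [AddCommGroup S] [Module R S]
    [AddCommGroup X] [Module R X] {ι : Type*} [Fintype ι] (f : ι → X →ₗ[R] S) (g : ι → S →ₗ[R] X)
    (h : ∑ i, g i ∘ₗ f i = LinearMap.id) (j : ℕ) [Subsingleton (ExtMod R S C j)] :
    Subsingleton (ExtMod R X C j) :=
  subsingleton_of_forall_eq 0 fun η =>
    ext_eq_zero_of_sum_comp_eq_id C f g h j η fun _ => Subsingleton.elim _ _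

theorem smul_pi_quotient_eq_zero {n : ℕ} (r : R) (hr : r ∈ I) (x : Fin n → R ⧸ I) :
    r • x = 0 := by
  ext i
  obtain ⟨s, hs⟩ := Submodule.Quotient.mk_surjective _ (x i)
  rw [Pi.smul_apply, ← hs, ← Submodule.Quotient.mk_smul, Pi.zero_apply,
    Submodule.Quotient.mk_eq_zero]
  exact I.mul_mem_right s hr

theorem sum_single_comp_proj_eq_id (S : Type u) [AddCommGroup S] [Module R S] (n : ℕ) :
    ∑ i, LinearMap.single R (fun _ : Fin n => S) i ∘ₗ LinearMap.proj i = LinearMap.id := by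
  ext i x j
  simp [Finset.sum_apply, Pi.single_apply]

theorem exists_surjective_pi_quotient {X : Type u} [AddCommGroup X] [Module R X]
    [Module.Finite R X] (hX : ∀ r ∈ I, ∀ x : X, r • x = 0) :
    ∃ (n : ℕ) (p : (Fin n → R ⧸ I) →ₗ[R] X), Function.Surjective p := by
  obtain ⟨n, v, hv⟩ := Module.Finite.exists_fin (R := R) (M := X)
  refine ⟨n, ∑ i, quotientOrbit hX (v i) ∘ₗ LinearMap.proj i, fun x => ?_⟩
  obtain ⟨c, rfl⟩ := (Submodule.mem_span_range_iff_exists_fun R).1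
    (show x ∈ Submodule.span R (Set.range v) from hv ▸ trivial)
  exact ⟨fun i => c i • 1, by simp⟩

variable [IsNoetherianRing R]

/-- If `Ext^i(R/I, C)` vanishes below degree `k`, then so does `Ext^i(X, C)` for all finite `X`
killed by `I`. -/
theorem subsingleton_ext_of_smul_eq_zero {k : ℕ}
    (h : ∀ i < k, Subsingleton (ExtMod R (R ⧸ I) C i)) (i : ℕ) (hi : i < k) :
    ∀ {X : Type u} [AddCommGroup X] [Module R X] [Module.Finite R X]
      (_ : ∀ r ∈ I, ∀ x : X, r • x = 0), Subsingleton (ExtMod R X C i) := by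
  induction i with
  | zero =>
    intro X _ _ _ hX
    obtain ⟨n, p, hp⟩ := exists_surjective_pi_quotient hX
    have := h 0 hi
    have := subsingleton_ext_of_sum_comp_eq_id C (fun i => LinearMap.proj i)
      (LinearMap.single R fun _ => R ⧸ I) (sum_single_comp_proj_eq_id (R ⧸ I) n) 0
    exact (extPullback_zero_injective C hp).subsingleton
  | succ i ih =>
    intro X _ _ _ hX
    obtain ⟨n, p, hp⟩ := exists_surjective_pi_quotient hX
    have := h (i + 1) hi
    have := subsingleton_ext_of_sum_comp_eq_id C (fun i => LinearMap.proj i)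
      (LinearMap.single R fun _ => R ⧸ I) (sum_single_comp_proj_eq_id (R ⧸ I) n) (i + 1)
    have := ih (by omega) (X := LinearMap.ker p)
      (fun r hr x => Subtype.ext (smul_pi_quotient_eq_zero r hr x.1))
    exact (extPullback_injective C (LinearMap.ker p).subtype p (LinearMap.ker p).injective_subtype
      (LinearMap.exact_subtype_ker_map p) hp (add_comm 1 i)).subsingleton

/-- If `Ext^i(R/I, C)` vanishes below degree `k`, then `Ext^k(X, C) ≃ Hom(X, Ext^k(R/I, C))` for all
finite `X` killed by `I`: the functor `Ext^k(-, C)` is left exact on these modules. -/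
theorem extOrbit_bijective {k : ℕ} (hk : 0 < k)
    (h : ∀ i < k, Subsingleton (ExtMod R (R ⧸ I) C i)) {X : Type u} [AddCommGroup X] [Module R X]
    [Module.Finite R X] (hX : ∀ r ∈ I, ∀ x : X, r • x = 0) :
    Function.Bijective (extOrbit C hX k) := by
  have hpull {X : Type u} [AddCommGroup X] [Module R X] [Module.Finite R X]
      (hX : ∀ r ∈ I, ∀ x : X, r • x = 0) {n : ℕ} (p : (Fin n → R ⧸ I) →ₗ[R] X)
      (hp : Function.Surjective p) : Function.Injective (extPullback C p k) := by
    have := subsingleton_ext_of_smul_eq_zero C h (k - 1) (by omega) (X := LinearMap.ker p)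
      (fun r hr x => Subtype.ext (smul_pi_quotient_eq_zero r hr x.1))
    exact extPullback_injective C (LinearMap.ker p).subtype p (LinearMap.ker p).injective_subtype
      (LinearMap.exact_subtype_ker_map p) hp (i := k - 1) (by omega)
  have hcomp {X Y : Type u} [AddCommGroup X] [Module R X] [AddCommGroup Y]
      [Module R Y] (hX : ∀ r ∈ I, ∀ x : X, r • x = 0) (hY : ∀ r ∈ I, ∀ y : Y, r • y = 0)
      (g : X →ₗ[R] Y) (η : ExtMod R Y C k) (x : X) :
      extOrbit C hX k (extPullback C g k η) x = extOrbit C hY k η (g x) := by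
    rw [extOrbit_apply, extOrbit_apply, ← extPullback_comp, quotientOrbit_comp hX hY]
  have hinj {X : Type u} [AddCommGroup X] [Module R X] [Module.Finite R X]
      (hX : ∀ r ∈ I, ∀ x : X, r • x = 0) : Function.Injective (extOrbit C hX k) := by
    rw [injective_iff_map_eq_zero]
    intro η hη
    obtain ⟨n, p, hp⟩ := exists_surjective_pi_quotient hX
    apply hpull hX p hp
    rw [map_zero]
    refine ext_eq_zero_of_sum_comp_eq_id C (fun i => LinearMap.proj i)
      (LinearMap.single R fun _ => R ⧸ I) (sum_single_comp_proj_eq_id (R ⧸ I) n) k _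
      fun i => ?_
    have h1 : LinearMap.single R (fun _ : Fin n => R ⧸ I) i =
        quotientOrbit smul_pi_quotient_eq_zero (Pi.single i 1) :=
      quotient_hom_ext (by simp)
    rw [h1, ← extOrbit_apply, hcomp _ hX, hη, LinearMap.zero_apply]
  refine ⟨hinj hX, fun l => ?_⟩
  obtain ⟨n, p, hp⟩ := exists_surjective_pi_quotient hX
  let ε (i : Fin n) : Fin n → R ⧸ I := Pi.single i 1
  let ζ : ExtMod R (Fin n → R ⧸ I) C k :=
    ∑ i, extPullback C (LinearMap.proj i) k (l (p (ε i)))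
  have hI : ∀ r ∈ I, ∀ x : R ⧸ I, r • x = 0 := by
    intro r hr x
    have := congrFun (smul_pi_quotient_eq_zero (n := 1) r hr (fun _ => x)) 0
    exact this
  have hζ : ∀ x, extOrbit C smul_pi_quotient_eq_zero k ζ x = l (p x) := by
    intro x
    choose r hr using fun i => Submodule.Quotient.mk_surjective _ (x i)
    have hx : x = ∑ i, r i • ε i := by
      ext i
      rw [Finset.sum_apply, ← hr i]
      simp [ε, Pi.single_apply, quotient_mk_eq_smul_one, -Ideal.Quotient.mk_eq_mk]
    have hterm (i : Fin n) : extOrbit C smul_pi_quotient_eq_zero k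
        (extPullback C (LinearMap.proj i) k (l (p (ε i)))) x = r i • l (p (ε i)) := by
      rw [hcomp _ hI, LinearMap.proj_apply, ← hr i, extOrbit_apply, quotient_mk_eq_smul_one,
        quotientOrbit_smul_one,
        extPullback_smul, extPullback_id]
    rw [map_sum, LinearMap.sum_apply, Finset.sum_congr rfl fun i _ => hterm i]
    conv_rhs => rw [hx]
    simp only [map_sum, map_smul]
  have hker : extPullback C (LinearMap.ker p).subtype k ζ = 0 := by
    apply hinj (X := LinearMap.ker p)
      (fun r hr x => Subtype.ext (smul_pi_quotient_eq_zero r hr x.1))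
    ext x
    rw [hcomp _ smul_pi_quotient_eq_zero, hζ, map_zero, LinearMap.zero_apply]
    rw [Submodule.subtype_apply, LinearMap.mem_ker.1 x.2, map_zero]
  obtain ⟨η, hη⟩ := (ext_exact_pullback C (LinearMap.ker p).subtype p
    (LinearMap.ker p).injective_subtype (LinearMap.exact_subtype_ker_map p) hp k ζ).1 hker
  refine ⟨η, LinearMap.ext fun x => ?_⟩
  obtain ⟨y, rfl⟩ := hp x
  rw [← hζ, ← hη, hcomp smul_pi_quotient_eq_zero hX]

end Orbits

/-! ### The diagram of an `I`-free approximation -/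

section Diagram

theorem exists_factor_of_surjective {R X Y Z : Type*} [CommRing R] [AddCommGroup X] [Module R X]
    [AddCommGroup Y] [Module R Y] [AddCommGroup Z] [Module R Z] {p : X →ₗ[R] Y}
    (hp : Function.Surjective p) {g : X →ₗ[R] Z} (h : LinearMap.ker p ≤ LinearMap.ker g) :
    ∃ l : Y →ₗ[R] Z, l ∘ₗ p = g := by
  refine ⟨(LinearMap.ker p).liftQ g h ∘ₗ (p.quotKerEquivOfSurjective hp).symm.toLinearMap,
    LinearMap.ext fun x => ?_⟩
  have : (p.quotKerEquivOfSurjective hp).symm (p x) = Submodule.Quotient.mk x := by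
    rw [LinearEquiv.symm_apply_eq]; rfl
  rw [LinearMap.comp_apply, LinearMap.comp_apply, LinearEquiv.coe_coe, this,
    Submodule.liftQ_apply]

theorem exists_factor_of_injective {R X Y Z : Type*} [CommRing R] [AddCommGroup X] [Module R X]
    [AddCommGroup Y] [Module R Y] [AddCommGroup Z] [Module R Z] {j : Y →ₗ[R] Z}
    (hj : Function.Injective j) {g : X →ₗ[R] Z} (h : ∀ x, g x ∈ LinearMap.range j) :
    ∃ l : X →ₗ[R] Y, j ∘ₗ l = g := by
  refine ⟨(LinearEquiv.ofInjective j hj).symm.toLinearMap ∘ₗ g.codRestrict _ h,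
    LinearMap.ext fun x => ?_⟩
  exact congrArg Subtype.val
    ((LinearEquiv.ofInjective j hj).apply_symm_apply (g.codRestrict _ h x))

variable {R : Type u} [CommRing R] {I : Ideal R} {F M W : Type u} [AddCommGroup F] [Module R F]
  [AddCommGroup M] [Module R M] [AddCommGroup W] [Module R W] {A : Approximation I F M W}
  {ω : Type u} [AddCommGroup ω] [Module R ω]

theorem apply_mem_idealMul {N P : Type u} [AddCommGroup N] [Module R N] [AddCommGroup P]
    [Module R P] (φ : N →ₗ[R] P) {x : N} (hx : x ∈ idealMul I N) : φ x ∈ idealMul I P :=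
  (Submodule.smul_le.2 fun r hr n _ => by
    rw [Submodule.mem_comap, map_smul]
    exact Submodule.smul_mem_smul hr trivial :
      idealMul I N ≤ Submodule.comap φ (idealMul I P)) hx

theorem mkQ_comp_eq_zero_iff {N P : Type*} [AddCommGroup N] [Module R N] [AddCommGroup P]
    [Module R P] {L : Submodule R P} {φ : N →ₗ[R] P} :
    L.mkQ ∘ₗ φ = 0 ↔ ∀ x, φ x ∈ L := by
  simp [LinearMap.ext_iff]

theorem exists_lift_reduction [Module.Free R F] (χ : F →ₗ[R] reduction I ω) :
    ∃ φ : F →ₗ[R] ω, (idealMul I ω).mkQ ∘ₗ φ = χ :=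
  Module.projective_lifting_property _ _ (Submodule.mkQ_surjective _)

namespace DualDiagram

variable (D : DualDiagram A ω)

theorem lam_comp_kappa (hM : Function.Injective (LinearMap.lcomp R ω A.iota))
    (ψ : M →ₗ[R] idealMul I ω) : D.lam ψ ∘ₗ D.kappa = (idealMul I ω).subtype ∘ₗ ψ :=
  hM (LinearMap.ext fun x => by
    simp only [LinearMap.lcomp_apply, LinearMap.comp_apply, D.kappa_iota, D.lam_apply,
      Submodule.subtype_apply])

theorem lam_apply_kappa (hM : Function.Injective (LinearMap.lcomp R ω A.iota))
    (ψ : M →ₗ[R] idealMul I ω) (m : M) : D.lam ψ (D.kappa m) = ψ m :=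
  LinearMap.congr_fun (D.lam_comp_kappa hM ψ) m

theorem lam_eq (hω : Function.Injective (LinearMap.lcomp R ω (idealMul I F).subtype))
    {φ : F →ₗ[R] ω} {ψ : M →ₗ[R] idealMul I ω} (h : ∀ m, (ψ m : ω) = φ (D.kappa m)) :
    D.lam ψ = φ :=
  hω (LinearMap.ext fun x => by
    rw [LinearMap.lcomp_apply, LinearMap.lcomp_apply, Submodule.subtype_apply, D.lam_apply, h,
      D.kappa_iota])

theorem alphaBar_surjective : Function.Surjective D.alphaBar := fun v => by
  obtain ⟨φ, rfl⟩ := Submodule.mkQ_surjective _ v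
  exact ⟨_, D.alphaBar_comp φ⟩

theorem nu_injective (hω : Function.Injective (LinearMap.lcomp R ω (idealMul I F).subtype)) :
    Function.Injective D.nu := by
  rw [injective_iff_map_eq_zero]
  intro v hv
  obtain ⟨φ, rfl⟩ := Submodule.mkQ_surjective _ v
  have h (m : M) : φ (D.kappa m) ∈ idealMul I ω := by
    rw [← Submodule.Quotient.mk_eq_zero, ← Submodule.mkQ_apply, ← D.nu_mk, hv,
      LinearMap.zero_apply]
  rw [Submodule.mkQ_apply, Submodule.Quotient.mk_eq_zero]
  exact ⟨(φ ∘ₗ D.kappa).codRestrict _ h, D.lam_eq hω fun m => rfl⟩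

theorem lamBar_injective (hM : Function.Injective (LinearMap.lcomp R ω A.iota)) :
    Function.Injective D.lamBar := by
  rw [injective_iff_map_eq_zero]
  intro v hv
  obtain ⟨ψ, rfl⟩ := Submodule.mkQ_surjective _ v
  rw [D.lamBar_mk, mkQ_comp_eq_zero_iff] at hv
  rw [Submodule.mkQ_apply, Submodule.Quotient.mk_eq_zero]
  exact ⟨(D.lam ψ).codRestrict _ hv, LinearMap.ext fun m => Subtype.ext (D.lam_apply_kappa hM ψ m)⟩

theorem range_lamBar [Module.Free R F] :
    LinearMap.range D.lamBar = LinearMap.ker D.alphaBar := by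
  apply le_antisymm
  · rintro _ ⟨v, rfl⟩
    obtain ⟨ψ, rfl⟩ := Submodule.mkQ_surjective _ v
    rw [LinearMap.mem_ker, D.lamBar_mk, D.alphaBar_comp, Submodule.mkQ_apply,
      Submodule.Quotient.mk_eq_zero]
    exact ⟨ψ, rfl⟩
  · intro χ hχ
    obtain ⟨φ, rfl⟩ := exists_lift_reduction χ
    rw [LinearMap.mem_ker, D.alphaBar_comp, Submodule.mkQ_apply,
      Submodule.Quotient.mk_eq_zero] at hχ
    obtain ⟨ψ, rfl⟩ := hχ
    exact ⟨_, D.lamBar_mk ψ⟩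

theorem eq_of_injective [Module.Free R F]
    (hF : Function.Injective (LinearMap.lcomp R F A.iota))
    (hω : Function.Injective (LinearMap.lcomp R ω (idealMul I F).subtype))
    (D' : DualDiagram A ω) : D' = D := by
  obtain ⟨κ, hκ, l, hl, a, ha, b, hb, n, hn⟩ := D
  obtain ⟨κ', hκ', l', hl', a', ha', b', hb', n', hn'⟩ := D'
  obtain rfl : κ' = κ := hF (LinearMap.ext fun x => (hκ' x).trans (hκ x).symm)
  obtain rfl : l' = l := LinearMap.ext fun ψ =>
    hω (LinearMap.ext fun x => (hl' ψ x).trans (hl ψ x).symm)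
  obtain rfl : a' = a := LinearMap.ext fun χ => by
    obtain ⟨φ, rfl⟩ := exists_lift_reduction χ
    rw [ha, ha']
  obtain rfl : b' = b := LinearMap.ext fun v => by
    obtain ⟨ψ, rfl⟩ := Submodule.mkQ_surjective _ v
    rw [hb, hb']
  obtain rfl : n' = n := LinearMap.ext fun v => LinearMap.ext fun w => by
    obtain ⟨φ, rfl⟩ := Submodule.mkQ_surjective _ v
    obtain ⟨m, rfl⟩ := A.rho_surjective w
    rw [hn, hn']
  rfl

end DualDiagram

/-- The maps `kappa` and `lam` exist because linear maps to `F` and to `ω` extend uniquely from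
`I F` to `M`, respectively to `F`; the remaining ones are induced on quotients. -/
theorem nonempty_dualDiagram [Module.Free R F]
    (hF : Function.Bijective (LinearMap.lcomp R F A.iota))
    (hM : Function.Injective (LinearMap.lcomp R ω A.iota))
    (hω : Function.Bijective (LinearMap.lcomp R ω (idealMul I F).subtype)) :
    Nonempty (DualDiagram A ω) := by
  obtain ⟨κ, hκ⟩ := hF.2 (idealMul I F).subtype
  obtain ⟨lam, hlam⟩ := exists_factor_of_injective hω.1
    (g := (LinearMap.lcomp R ω A.iota) ∘ₗ (LinearMap.compRight R (idealMul I ω).subtype))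
    fun x => hω.2 _
  replace hκ (x : idealMul I F) : κ (A.iota x) = x := LinearMap.congr_fun hκ x
  replace hlam (ψ : M →ₗ[R] idealMul I ω) (x : idealMul I F) : lam ψ (x : F) = ψ (A.iota x) :=
    LinearMap.congr_fun (LinearMap.congr_fun hlam ψ) x
  have hlamκ (ψ : M →ₗ[R] idealMul I ω) (m : M) : lam ψ (κ m) = ψ m :=
    LinearMap.congr_fun (hM (LinearMap.ext fun x => by
      simp only [LinearMap.lcomp_apply, LinearMap.comp_apply, hκ, hlam,
        Submodule.subtype_apply]) : lam ψ ∘ₗ κ = (idealMul I ω).subtype ∘ₗ ψ) m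
  have hlam' (φ : F →ₗ[R] idealMul I ω) : lam (φ ∘ₗ κ) = (idealMul I ω).subtype ∘ₗ φ :=
    hω.1 (LinearMap.ext fun x => by
      simp only [LinearMap.lcomp_apply, Submodule.subtype_apply, LinearMap.comp_apply, hκ, hlam])
  obtain ⟨a, ha⟩ := exists_factor_of_surjective (R := R)
    (p := LinearMap.compRight R (M := F) (idealMul I ω).mkQ) (g := (LinearMap.range lam).mkQ)
    exists_lift_reduction (fun φ hφ => by
      have h : ∀ x, φ x ∈ idealMul I ω := mkQ_comp_eq_zero_iff.1 hφ
      rw [Submodule.ker_mkQ]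
      exact ⟨φ.codRestrict _ h ∘ₗ κ, by rw [hlam']; rfl⟩)
  obtain ⟨b, hb⟩ := exists_factor_of_surjective (R := R)
    (Submodule.mkQ_surjective (LinearMap.range (precompKappa ω κ)))
    (g := LinearMap.compRight R (idealMul I ω).mkQ ∘ₗ lam) (by
      rw [Submodule.ker_mkQ]
      rintro _ ⟨φ, rfl⟩
      rw [LinearMap.mem_ker, LinearMap.comp_apply, LinearMap.lcomp_apply', hlam']
      exact mkQ_comp_eq_zero_iff.2 fun x => (φ x).2)
  obtain ⟨n₀, hn₀⟩ := exists_factor_of_injective (R := R)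
    (j := LinearMap.lcomp R (reduction I ω) A.rho)
    (LinearMap.lcomp_injective_of_surjective _ A.rho_surjective)
    (g := LinearMap.lcomp R (reduction I ω) κ ∘ₗ LinearMap.compRight R (idealMul I ω).mkQ)
    (fun φ => by
      obtain ⟨l, hl⟩ := exists_factor_of_surjective (R := R) A.rho_surjective
        (g := ((idealMul I ω).mkQ ∘ₗ φ) ∘ₗ κ) (fun m hm => by
          obtain ⟨x, rfl⟩ := (A.exact m).1 hm
          rw [LinearMap.mem_ker, LinearMap.comp_apply, hκ, LinearMap.comp_apply,
            Submodule.mkQ_apply, Submodule.Quotient.mk_eq_zero]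
          exact apply_mem_idealMul φ x.2)
      exact ⟨l, hl⟩)
  obtain ⟨n, hn⟩ := exists_factor_of_surjective (R := R)
    (Submodule.mkQ_surjective (LinearMap.range lam)) (g := n₀) (by
      rw [Submodule.ker_mkQ]
      rintro _ ⟨ψ, rfl⟩
      refine LinearMap.ext fun w => ?_
      obtain ⟨m, rfl⟩ := A.rho_surjective w
      refine (LinearMap.congr_fun (LinearMap.congr_fun hn₀ (lam ψ)) m).trans ?_
      refine (Submodule.Quotient.mk_eq_zero _).2 ?_
      change lam ψ (κ m) ∈ _
      rw [hlamκ]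
      exact (ψ m).2)
  exact ⟨{
    kappa := κ
    kappa_iota := hκ
    lam := lam
    lam_apply := hlam
    alphaBar := a
    alphaBar_comp := fun φ => LinearMap.congr_fun ha φ
    lamBar := b
    lamBar_mk := fun ψ => LinearMap.congr_fun hb ψ
    nu := n
    nu_mk := fun φ m =>
      (LinearMap.congr_fun (LinearMap.congr_fun hn φ) _).trans
        (LinearMap.congr_fun (LinearMap.congr_fun hn₀ φ) m) }⟩

end Diagram

/-! ### Unique extension of linear maps -/

section Extension

variable {R : Type u} [CommRing R]

/-- Linear maps to `C` extend uniquely along an injection whose cokernel `D` satisfies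
`Hom(D, C) = 0` and `Ext^1(D, C) = 0`. -/
theorem lcomp_bijective_of_subsingleton_ext {A B D : Type u} [AddCommGroup A] [Module R A]
    [AddCommGroup B] [Module R B] [AddCommGroup D] [Module R D] (C : Type u) [AddCommGroup C]
    [Module R C] {f : A →ₗ[R] B} {g : B →ₗ[R] D} (hf : Function.Injective f)
    (h : Function.Exact f g) (hg : Function.Surjective g) [Subsingleton (ExtMod R D C 0)]
    [Subsingleton (ExtMod R D C 1)] : Function.Bijective (LinearMap.lcomp R C f) := by
  have heq (x : ExtMod R B C 0) : extZeroEquiv C (extPullback C f 0 x) =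
      LinearMap.lcomp R C f (extZeroEquiv C x) := extZeroEquiv_extPullback C f x
  constructor
  · rw [injective_iff_map_eq_zero]
    intro l hl
    obtain ⟨x, rfl⟩ := (extZeroEquiv C).surjective l
    rw [← heq, LinearEquiv.map_eq_zero_iff] at hl
    obtain ⟨y, rfl⟩ := (ext_exact_pullback C f g hf h hg 0 x).1 hl
    rw [Subsingleton.elim y 0, map_zero, map_zero]
  · intro l
    obtain ⟨x, hx⟩ := extPullback_surjective C f g hf h hg (add_zero 1) ((extZeroEquiv C).symm l)
    exact ⟨extZeroEquiv C x, by rw [← heq, hx, LinearEquiv.apply_symm_apply]⟩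

theorem lcomp_bijective_of_equiv_pi {A B C F : Type*} [AddCommGroup A] [Module R A]
    [AddCommGroup B] [Module R B] [AddCommGroup C] [Module R C] [AddCommGroup F] [Module R F]
    {ι : Type*} (e : F ≃ₗ[R] (ι → C)) {f : A →ₗ[R] B}
    (h : Function.Bijective (LinearMap.lcomp R C f)) :
    Function.Bijective (LinearMap.lcomp R F f) := by
  constructor
  · intro l l' hl
    refine LinearMap.ext fun x => e.injective (funext fun i => ?_)
    refine LinearMap.congr_fun (h.1 (a₁ := LinearMap.proj i ∘ₗ e.toLinearMap ∘ₗ l)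
      (a₂ := LinearMap.proj i ∘ₗ e.toLinearMap ∘ₗ l') (LinearMap.ext fun a => ?_)) x
    exact congrArg (fun y => e y i) (LinearMap.congr_fun hl a)
  · intro l
    choose t ht using fun i => h.2 (LinearMap.proj i ∘ₗ e.toLinearMap ∘ₗ l)
    refine ⟨e.symm.toLinearMap ∘ₗ LinearMap.pi t, LinearMap.ext fun a => e.injective ?_⟩
    refine (e.apply_symm_apply _).trans (funext fun i => ?_)
    exact LinearMap.congr_fun (ht i) a

end Extension

/-! ### The connecting map -/

section Approximation

variable {R : Type u} [CommRing R] {I : Ideal R} {F M W : Type u} [AddCommGroup F] [Module R F]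
  [AddCommGroup M] [Module R M] [AddCommGroup W] [Module R W] (A : Approximation I F M W)
  {ω : Type u} [AddCommGroup ω] [Module R ω]

include A in
/-- If `I` contains a nonzerodivisor `r`, then multiplication by `r` embeds `F` in `I F ⊆ M`. -/
theorem Approximation.finite [IsNoetherianRing R] [Module.Free R F] [Module.Finite R M] {r : R}
    (hr : r ∈ I) (hreg : IsSMulRegular R r) : Module.Finite R F := by
  have hF : IsSMulRegular F r := by
    intro x y hxy
    refine (Module.Free.chooseBasis R F).repr.injective (Finsupp.ext fun i => hreg ?_)
    simpa using congrArg (fun z => (Module.Free.chooseBasis R F).repr z i) hxy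
  have hmem (x : F) : LinearMap.lsmul R F r x ∈ idealMul I F := Submodule.smul_mem_smul hr trivial
  refine Module.Finite.of_injective (A.iota ∘ₗ (LinearMap.lsmul R F r).codRestrict _ hmem) ?_
  exact A.iota_injective.comp fun x y hxy => hF (congrArg Subtype.val hxy)

theorem smul_reduction_eq_zero (N : Type u) [AddCommGroup N] [Module R N] (r : R) (hr : r ∈ I)
    (x : reduction I N) : r • x = 0 := by
  obtain ⟨y, rfl⟩ := Submodule.mkQ_surjective _ x
  rw [← map_smul, Submodule.mkQ_apply, Submodule.Quotient.mk_eq_zero]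
  exact Submodule.smul_mem_smul hr trivial

theorem lcomp_mkQ_reduction_bijective (N : Type u) [AddCommGroup N] [Module R N]
    (hN : ∀ r ∈ I, ∀ x : N, r • x = 0) :
    Function.Bijective (LinearMap.lcomp R N (idealMul I F).mkQ) := by
  refine ⟨LinearMap.lcomp_injective_of_surjective _ (Submodule.mkQ_surjective _), fun χ => ?_⟩
  have h : idealMul I F ≤ LinearMap.ker χ := Submodule.smul_le.2 fun r hr f _ => by
    rw [LinearMap.mem_ker, map_smul, hN r hr]
  exact ⟨(idealMul I F).liftQ χ h, (idealMul I F).liftQ_mkQ χ h⟩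

variable {A} (D : DualDiagram A ω)

theorem DualDiagram.nu_alphaBar [Module.Free R F] (χ : F →ₗ[R] reduction I ω) (m : M) :
    D.nu (D.alphaBar χ) (A.rho m) = χ (D.kappa m) := by
  obtain ⟨φ, rfl⟩ := exists_lift_reduction χ
  rw [D.alphaBar_comp, D.nu_mk, LinearMap.comp_apply]

/-- The map `W → F / I F` induced by `kappa`. -/
theorem DualDiagram.exists_kappa_reduction :
    ∃ l : W →ₗ[R] reduction I F, (idealMul I F).mkQ ∘ₗ D.kappa = l ∘ₗ A.rho := by
  obtain ⟨l, hl⟩ := exists_factor_of_surjective A.rho_surjective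
    (g := (idealMul I F).mkQ ∘ₗ D.kappa) (fun m hm => by
      obtain ⟨x, rfl⟩ := (A.exact m).1 hm
      rw [LinearMap.mem_ker, LinearMap.comp_apply, D.kappa_iota, Submodule.mkQ_apply,
        Submodule.Quotient.mk_eq_zero]
      exact x.2)
  exact ⟨l, hl.symm⟩

variable [IsNoetherianRing R] [Module.Free R F] [Module.Finite R F] [Module.Finite R M]

variable (I F) in
/-- The connecting map `Ext^{k-1}(I F, C) → Ext^k(F / I F, C)`. -/
noncomputable def freeConnecting (C : Type u) [AddCommGroup C] [Module R C] {i j : ℕ}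
    (hij : 1 + i = j) : ExtMod R (idealMul I F) C i →ₗ[R] ExtMod R (reduction I F) C j :=
  extConnecting C (idealMul I F).subtype (idealMul I F).mkQ (Submodule.injective_subtype _)
    (LinearMap.exact_subtype_mkQ _) (Submodule.mkQ_surjective _) hij

omit [IsNoetherianRing R] [Module.Finite R F] in
theorem freeConnecting_bijective (C : Type u) [AddCommGroup C] [Module R C] {i j : ℕ}
    (hij : 1 + i = j) (hi : i ≠ 0) : Function.Bijective (freeConnecting I F C hij) := by
  obtain ⟨i, rfl⟩ := Nat.exists_eq_succ_of_ne_zero hi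
  obtain rfl : j = i + 1 + 1 := by omega
  have h1 : Subsingleton (ExtMod R F C (i + 1)) := subsingleton_ext_of_projective C i
  have h2 : Subsingleton (ExtMod R F C (i + 1 + 1)) := subsingleton_ext_of_projective C (i + 1)
  exact ⟨extConnecting_injective C _ _ _ _ _ hij, extConnecting_surjective C _ _ _ _ _ hij⟩

omit [IsNoetherianRing R] [Module.Finite R F] [Module.Finite R M] [Module.Free R F] in
/-- Naturality of the connecting map with respect to `φ : F → R`, evaluated at the class of `f`. -/
theorem extPullback_quotientOrbit_freeConnecting (C : Type u) [AddCommGroup C] [Module R C]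
    {i j : ℕ} (hij : 1 + i = j) (φ : F →ₗ[R] R) (ξ : ExtMod R I C i) (f : F) :
    extPullback C (quotientOrbit (smul_reduction_eq_zero F) ((idealMul I F).mkQ f)) j
      (freeConnecting I F C hij (extPullback C (restrictForm φ) i ξ)) =
    φ f • idealConnecting I C hij ξ := by
  have hφ : idealMul I F ≤ Submodule.comap φ I := fun x hx => (restrictForm φ ⟨x, hx⟩).2
  rw [freeConnecting, extConnecting_naturality C _ _ _ _ _ (Submodule.subtype I)
    (Submodule.mkQ I) (Submodule.injective_subtype I) (LinearMap.exact_subtype_mkQ I)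
    (Submodule.mkQ_surjective I) (restrictForm φ) φ ((idealMul I F).mapQ I φ hφ) rfl
    (Submodule.mapQ_mkQ _ _ _).symm hij, ← extPullback_comp]
  rw [show (idealMul I F).mapQ I φ hφ ∘ₗ
      quotientOrbit (smul_reduction_eq_zero F) ((idealMul I F).mkQ f) = φ f • LinearMap.id from
    quotient_hom_ext (by
      rw [LinearMap.comp_apply, quotientOrbit_one, LinearMap.smul_apply, LinearMap.id_apply]
      exact quotient_mk_eq_smul_one _), extPullback_smul, extPullback_id]
  rfl

/-- `Φ` is the connecting map to `Ext^k(F / I F, C)` followed by the isomorphism with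
`Hom(F / I F, Ext^k(R/I, C))`, and `Γ` is the corresponding isomorphism for `W`. -/
theorem connectingMapIsAlphaBar (C : Type u) [AddCommGroup C] [Module R C] {k : ℕ} (hk : 2 ≤ k)
    (hk' : 1 + (k - 1) = k) (h : ∀ i < k, Subsingleton (ExtMod R (R ⧸ I) C i))
    (hθ : Nonempty (reduction I ω ≃ₗ[R] ExtMod R (R ⧸ I) C k)) :
    ConnectingMapIsAlphaBar D C k hk' := by
  refine ⟨hθ, fun θ => ?_⟩
  have : Module.Finite R W := Module.Finite.of_surjective A.rho A.rho_surjective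
  let e₁ := LinearEquiv.ofBijective _ (freeConnecting_bijective (I := I) (F := F) C hk' (by omega))
  let e₂ := LinearEquiv.ofBijective _
    (extOrbit_bijective C (by omega) h (smul_reduction_eq_zero (I := I) F))
  let e₄ := LinearEquiv.ofBijective _
    (lcomp_mkQ_reduction_bijective (F := F) _ (smul_reduction_eq_zero (I := I) ω))
  let Φ := e₁ ≪≫ₗ e₂ ≪≫ₗ LinearEquiv.congrRight θ.symm ≪≫ₗ e₄
  let Γ := LinearEquiv.ofBijective _ (extOrbit_bijective C (by omega) h A.smul_eq_zero) ≪≫ₗ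
    LinearEquiv.congrRight θ.symm
  have hΦ (ζ f) : Φ ζ f = θ.symm (extOrbit C (smul_reduction_eq_zero F) k
    (freeConnecting I F C hk' ζ) ((idealMul I F).mkQ f)) := rfl
  have hΓ (η w) : Γ η w = θ.symm (extPullback C (A.orbit w) k η) := rfl
  refine ⟨Φ, Γ, fun φ ξ f => ?_, fun η w => ?_, fun ζ => LinearMap.ext fun w => ?_⟩
  · rw [hΦ, LinearEquiv.apply_symm_apply, extOrbit_apply,
      extPullback_quotientOrbit_freeConnecting]
  · rw [hΓ, LinearEquiv.apply_symm_apply]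
  · obtain ⟨m, rfl⟩ := A.rho_surjective w
    obtain ⟨l, hl⟩ := D.exists_kappa_reduction
    have hβ : A.beta C hk' ζ = extPullback C l k (freeConnecting I F C hk' ζ) := by
      have := extConnecting_naturality C A.iota A.rho A.iota_injective A.exact A.rho_surjective
        (idealMul I F).subtype (idealMul I F).mkQ (Submodule.injective_subtype _)
        (LinearMap.exact_subtype_mkQ _) (Submodule.mkQ_surjective _) LinearMap.id D.kappa l
        (LinearMap.ext fun x => (D.kappa_iota x).symm) hl hk' ζ
      rwa [extPullback_id] at this
    have hlm : (idealMul I F).mkQ (D.kappa m) = l (A.rho m) := LinearMap.congr_fun hl m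
    rw [D.nu_alphaBar, hΦ, hΓ, hβ, hlm, extOrbit_apply, ← extPullback_comp]
    rw [← quotientOrbit_comp A.smul_eq_zero]
    rfl

end Approximation

/-! ### Reflexivity -/

section Reflexivity

variable {R : Type u} [CommRing R] {I : Ideal R} {F M W : Type u} [AddCommGroup F] [Module R F]
  [AddCommGroup M] [Module R M] [AddCommGroup W] [Module R W] {A : Approximation I F M W}
  {ω : Type u} [AddCommGroup ω] [Module R ω] (D : DualDiagram A ω)

theorem mem_idealMul_of_forall_mem [Module.Free R F] [Module.Finite R F] (e : ω ≃ₗ[R] R) {x : F}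
    (h : ∀ φ : F →ₗ[R] ω, φ x ∈ idealMul I ω) : x ∈ idealMul I F := by
  let b := Module.Free.chooseBasis R F
  rw [← b.sum_repr x]
  refine Submodule.sum_mem _ fun i _ => Submodule.smul_mem_smul ?_ trivial
  have := apply_mem_idealMul e.toLinearMap (h (e.symm.toLinearMap ∘ₗ b.coord i))
  simpa [idealMul] using this

/-- A finite free module is reflexive, so if `ω ≃ R`, then every linear form `Hom(F, ω) → ω` is
the evaluation at an element of `F`. -/
theorem exists_eq_eval [Module.Free R F] [Module.Finite R F] (e : ω ≃ₗ[R] R)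
    (H : (F →ₗ[R] ω) →ₗ[R] ω) : ∃ f : F, ∀ φ, H φ = φ f := by
  obtain ⟨f, hf⟩ := (Module.evalEquiv R F).surjective
    (e.toLinearMap ∘ₗ H ∘ₗ LinearMap.compRight R e.symm.toLinearMap)
  refine ⟨f, fun φ => e.injective ?_⟩
  have h := LinearMap.congr_fun hf (e.toLinearMap ∘ₗ φ)
  have h' : e.symm.toLinearMap ∘ₗ e.toLinearMap ∘ₗ φ = φ := LinearMap.ext fun x => by simp
  simp only [LinearMap.comp_apply, LinearMap.compRight_apply, h'] at h
  exact h.symm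

/-- If `nu` also identifies `W` with `Hom(V, ω/Iω)`, then `nu` is, up to this identification, the
evaluation map of `V`. -/
theorem DualDiagram.isReflexiveWith_iff (hD : Function.Bijective D.nu.flip) :
    IsReflexiveWith R D.V (reduction I ω) ↔ Function.Bijective D.nu := by
  have hτ : Function.Bijective (LinearMap.lcomp R (reduction I ω) D.nu.flip) := by
    refine ⟨LinearMap.lcomp_injective_of_surjective _ hD.2, fun l => ?_⟩
    refine ⟨l ∘ₗ (LinearEquiv.ofBijective _ hD).symm.toLinearMap, LinearMap.ext fun w => ?_⟩
    exact congrArg l ((LinearEquiv.ofBijective _ hD).symm_apply_apply w)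
  exact (Function.Bijective.of_comp_iff' hτ _).symm

/-- If `ρ m` is in the kernel of `W → Hom(V, ω/Iω)`, then `kappa m ∈ I F`, and reflexivity gives
`m ∈ I F`, because every `ψ : M → Iω` satisfies `ψ m = lam ψ (kappa m)`. -/
theorem DualDiagram.flip_nu_injective [Module.Free R F] [Module.Finite R F] (e : ω ≃ₗ[R] R)
    (hM : Function.Injective (LinearMap.lcomp R ω A.iota))
    (hrefl : IsReflexiveWith R M (idealMul I ω)) : Function.Injective D.nu.flip := by
  rw [injective_iff_map_eq_zero]
  intro w hw
  obtain ⟨m, rfl⟩ := A.rho_surjective w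
  have hm : D.kappa m ∈ idealMul I F := mem_idealMul_of_forall_mem e fun φ => by
    rw [← Submodule.Quotient.mk_eq_zero, ← Submodule.mkQ_apply, ← D.nu_mk]
    exact LinearMap.congr_fun hw _
  have : m = A.iota ⟨D.kappa m, hm⟩ := hrefl.1 (LinearMap.ext fun ψ => Subtype.ext (by
    change (ψ m : ω) = ψ _
    rw [← D.lam_apply_kappa hM, ← D.lam_apply_kappa hM, D.kappa_iota]))
  exact (A.exact _).2 ⟨_, this.symm⟩

/-- A map `V → ω/Iω` lifts to `H : Hom(F, ω) → ω`, which is the evaluation at some `f ∈ F`.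
By reflexivity `H ∘ lam` is the evaluation at some `m ∈ M`, and the class of `m` in `W` is the
preimage. -/
theorem DualDiagram.flip_nu_surjective [Module.Free R F] [Module.Finite R F] (e : ω ≃ₗ[R] R)
    (hω : Function.Injective (LinearMap.lcomp R ω (idealMul I F).subtype)) {r : R} (hr : r ∈ I)
    (hreg : IsSMulRegular ω r) (hrefl : IsReflexiveWith R M (idealMul I ω)) :
    Function.Surjective D.nu.flip := by
  intro h
  have : Module.Projective R (F →ₗ[R] ω) :=
    Module.Projective.of_equiv (LinearEquiv.congrRight e.symm)
  obtain ⟨H, hH⟩ := Module.projective_lifting_property (idealMul I ω).mkQ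
    (h ∘ₗ (LinearMap.range D.lam).mkQ) (Submodule.mkQ_surjective _)
  replace hH (φ) : (idealMul I ω).mkQ (H φ) = h ((LinearMap.range D.lam).mkQ φ) :=
    LinearMap.congr_fun hH φ
  have hlam (ψ) : (H ∘ₗ D.lam) ψ ∈ idealMul I ω := by
    rw [← Submodule.Quotient.mk_eq_zero, ← Submodule.mkQ_apply, LinearMap.comp_apply, hH,
      Submodule.mkQ_apply, (Submodule.Quotient.mk_eq_zero _).2 (LinearMap.mem_range_self D.lam ψ),
      map_zero]
  -- By reflexivity of `M`, the form `H ∘ lam` is the evaluation at some `m`.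
  obtain ⟨m, hm⟩ := hrefl.2 ((H ∘ₗ D.lam).codRestrict _ hlam)
  replace hm (ψ : M →ₗ[R] idealMul I ω) : (ψ m : ω) = H (D.lam ψ) :=
    congrArg Subtype.val (LinearMap.congr_fun hm ψ)
  obtain ⟨f, hf⟩ := exists_eq_eval e H
  -- The evaluations at `kappa m` and at `f` agree on `Hom(F, Iω)`, hence on `r • φ` for all `φ`.
  have hφ (φ : F →ₗ[R] ω) : φ (D.kappa m) = φ f := by
    refine hreg ?_
    let φ' : F →ₗ[R] idealMul I ω :=
      (r • φ).codRestrict _ fun x => Submodule.smul_mem_smul hr trivial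
    have h1 : D.lam (φ' ∘ₗ D.kappa) = r • φ := D.lam_eq hω fun m => rfl
    have h2 := hm (φ' ∘ₗ D.kappa)
    rw [h1, hf] at h2
    exact h2
  refine ⟨A.rho m, LinearMap.ext fun v => ?_⟩
  obtain ⟨φ, rfl⟩ := Submodule.mkQ_surjective _ v
  rw [LinearMap.flip_apply, D.nu_mk, hφ, ← hf, hH]

end Reflexivity

/-! ### `Ext` of an `I`-free approximation -/

section ExtOfApproximation

variable {R : Type u} [CommRing R] {I : Ideal R} {F M W : Type u} [AddCommGroup F] [Module R F]
  [AddCommGroup M] [Module R M] [AddCommGroup W] [Module R W] (A : Approximation I F M W)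
  (C : Type u) [AddCommGroup C] [Module R C]

/-- The decomposition of `F / I F` as a sum of copies of `R/I`. -/
theorem sum_orbit_comp_coord_eq_id {ι : Type*} [Fintype ι] (b : Module.Basis ι R F) :
    ∑ i, quotientOrbit (smul_reduction_eq_zero F) ((idealMul I F).mkQ (b i)) ∘ₗ
      (idealMul I F).mapQ I (b.coord i) (fun x hx => (restrictForm (b.coord i) ⟨x, hx⟩).2) =
    LinearMap.id := by
  refine Submodule.linearMap_qext _ (LinearMap.ext fun x => ?_)
  rw [LinearMap.comp_apply, LinearMap.sum_apply]
  conv_rhs => rw [← b.sum_repr x, map_sum]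
  refine Finset.sum_congr rfl fun i _ => Eq.trans ?_ (map_smul _ _ _).symm
  rfl

/-- `Ext^k(I F, C)` is isomorphic to `Ext^{k+1}(F / I F, C)`, a sum of copies of
`Ext^{k+1}(R/I, C)`. -/
theorem subsingleton_ext_idealMul [Module.Free R F] [Module.Finite R F] {k : ℕ} (hk : k ≠ 0)
    [Subsingleton (ExtMod R (R ⧸ I) C (1 + k))] : Subsingleton (ExtMod R (idealMul I F) C k) := by
  have := subsingleton_ext_of_sum_comp_eq_id C _ _
    (sum_orbit_comp_coord_eq_id (I := I) (Module.Free.chooseBasis R F)) (1 + k)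
  exact (freeConnecting_bijective C rfl hk).1.subsingleton

theorem Approximation.beta_surjective_iff {i j : ℕ} (hij : 1 + i = j)
    [Subsingleton (ExtMod R (idealMul I F) C j)] :
    Function.Surjective (A.beta C hij) ↔ Subsingleton (ExtMod R M C j) := by
  have h1 := ext_exact_connecting_pullback C A.iota A.rho A.iota_injective A.exact
    A.rho_surjective hij
  have h2 := ext_exact_pullback C A.iota A.rho A.iota_injective A.exact A.rho_surjective j
  constructor
  · refine fun h => subsingleton_of_forall_eq 0 fun x => ?_
    obtain ⟨y, rfl⟩ := (h2 x).1 (Subsingleton.elim _ _)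
    exact (h1 y).2 (h y)
  · exact fun h y => (h1 y).1 (Subsingleton.elim _ _)

/-- If `Ext^i(W, C) = 0`, then `Ext^i(M, C)` is the kernel of
`β : Ext^i(I F, C) → Ext^{i+1}(W, C)`. -/
theorem Approximation.nonempty_ext_equiv {i j : ℕ} (hij : 1 + i = j)
    [Subsingleton (ExtMod R W C i)] {E E' : Type u} [AddCommGroup E] [Module R E]
    [AddCommGroup E'] [Module R E'] (Φ : ExtMod R (idealMul I F) C i ≃ₗ[R] E) (g : E →ₗ[R] E')
    (h : ∀ ζ, g (Φ ζ) = 0 ↔ A.beta C hij ζ = 0) :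
    Nonempty (ExtMod R M C i ≃ₗ[R] LinearMap.ker g) := by
  have hinj : Function.Injective (extPullback C A.iota i) := by
    rw [injective_iff_map_eq_zero]
    intro x hx
    obtain ⟨y, rfl⟩ := (ext_exact_pullback C A.iota A.rho A.iota_injective A.exact
      A.rho_surjective i x).1 hx
    rw [Subsingleton.elim y 0, map_zero]
  have hrange : LinearMap.range (Φ.toLinearMap ∘ₗ extPullback C A.iota i) = LinearMap.ker g := by
    ext x
    obtain ⟨ζ, rfl⟩ := Φ.surjective x
    have hex : A.beta C hij ζ = 0 ↔ ζ ∈ Set.range (extPullback C A.iota i) :=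
      ext_exact_pullback_connecting C A.iota A.rho A.iota_injective A.exact
        A.rho_surjective hij ζ
    rw [LinearMap.mem_ker, h, hex]
    simp
  exact ⟨LinearEquiv.ofInjective _ (Φ.injective.comp hinj) ≪≫ₗ LinearEquiv.ofEq _ _ hrange⟩

end ExtOfApproximation

end ResidualDuality

open ResidualDuality
theorem corollary2 {R : Type u} [CommRing R] [IsLocalRing R] (I : Ideal R) (k : ℕ)
    (hk : 2 ≤ k) (hI : I.height = (k : ℕ∞))
    (hR : IsCohenMacaulayLocalRing R) (hRI : IsCohenMacaulayLocalRing (R ⧸ I))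
    (hR' : IsGorensteinLocalRing R) (hRI' : IsGorensteinLocalRing (R ⧸ I))
    (ω : Type u) [AddCommGroup ω] [Module R ω] (hω : IsCanonicalModule R ω)
    (F M W : Type u) [AddCommGroup F] [Module R F] [AddCommGroup M] [Module R M]
    [AddCommGroup W] [Module R W] [Module.Free R F] [Module.Finite R M]
    (A : Approximation I F M W) :
    ∃ D : DualDiagram A ω, (∀ D' : DualDiagram A ω, D' = D) ∧
      Function.Surjective D.alphaBar ∧ Function.Injective D.nu ∧
      ConnectingMapIsAlphaBar D ω k (by omega) ∧
      ConnectingMapIsAlphaBar D R k (by omega) ∧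
      Nonempty (ExtMod R M R (k - 1) ≃ₗ[R] LinearMap.ker D.alphaBar) ∧
      Function.Injective D.lamBar ∧ LinearMap.range D.lamBar = LinearMap.ker D.alphaBar ∧
      (IsReflexiveWith R M (idealMul I ω) →
        (Subsingleton (ExtMod R M R k) ↔ IsReflexiveWith R D.V (reduction I ω))) := by
  have := hR.toIsNoetherian
  have hk' : 1 + (k - 1) = k := by omega
  obtain ⟨e⟩ := hω.nonempty_equiv hR hR'
  obtain ⟨hvan, ⟨eE⟩⟩ := ext_quotient_ideal hR hR' hI hRI hRI'
  have hvanR (i) (hi : i < k) : Subsingleton (ExtMod R (R ⧸ I) R i) := hvan i hi.ne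
  have hvanω (i) (hi : i < k) : Subsingleton (ExtMod R (R ⧸ I) ω i) :=
    have := hvanR i hi
    (extTargetEquiv e i).toEquiv.subsingleton
  -- `Hom(R/I, R) = 0`, so `I` contains a nonzerodivisor.
  obtain ⟨r, hr, hreg⟩ : ∃ r ∈ I, IsSMulRegular R r := by
    have := hvanR 0 (by omega)
    have : Subsingleton ((R ⧸ I) →ₗ[R] R) := (extZeroEquiv R).symm.toEquiv.subsingleton
    simpa [Ideal.annihilator_quotient] using
      (IsSMulRegular.subsingleton_linearMap_iff (N := R ⧸ I) (M := R)).1 this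
  have hregω : IsSMulRegular ω r := fun x y hxy =>
    e.injective (hreg (by simpa using congrArg e hxy))
  have : Module.Finite R F := A.finite hr hreg
  have : Module.Finite R W := Module.Finite.of_surjective A.rho A.rho_surjective
  have hW (i) (hi : i < k) : Subsingleton (ExtMod R W R i) :=
    subsingleton_ext_of_smul_eq_zero R hvanR i hi A.smul_eq_zero
  have hG (i) (hi : i < k) : Subsingleton (ExtMod R (reduction I F) R i) :=
    subsingleton_ext_of_smul_eq_zero R hvanR i hi (smul_reduction_eq_zero F)
  have := hW 0 (by omega)
  have := hW 1 (by omega)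
  have := hG 0 (by omega)
  have := hG 1 (by omega)
  have hMR : Function.Bijective (LinearMap.lcomp R R A.iota) :=
    lcomp_bijective_of_subsingleton_ext R A.iota_injective A.exact A.rho_surjective
  have hFR : Function.Bijective (LinearMap.lcomp R R (idealMul I F).subtype) :=
    lcomp_bijective_of_subsingleton_ext R (Submodule.injective_subtype _)
      (LinearMap.exact_subtype_mkQ _) (Submodule.mkQ_surjective _)
  have eω : ω ≃ₗ[R] (Fin 1 → R) := e ≪≫ₗ (LinearEquiv.funUnique (Fin 1) R R).symm
  have hM := lcomp_bijective_of_equiv_pi eω hMR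
  have hF := lcomp_bijective_of_equiv_pi (Module.Free.chooseBasis R F).equivFun hMR
  have hωF := lcomp_bijective_of_equiv_pi eω hFR
  obtain ⟨D⟩ := nonempty_dualDiagram hF hM.1 hωF
  -- `ω / Iω ≃ R/I ≃ Ext^k(R/I, R)`
  have hred : idealMul I ω = Submodule.comap e.toLinearMap I := le_antisymm
    (fun x hx => by simpa [idealMul] using apply_mem_idealMul e.toLinearMap hx)
    (fun x hx => by
      have hx' : e x ∈ idealMul I R := by simpa [idealMul] using hx
      simpa using apply_mem_idealMul e.symm.toLinearMap hx')
  have hθ : Nonempty (reduction I ω ≃ₗ[R] ExtMod R (R ⧸ I) R k) :=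
    ⟨Submodule.Quotient.equiv _ I e (by
      rw [hred]; exact Submodule.map_comap_eq_of_surjective e.surjective I) ≪≫ₗ eE.symm⟩
  have hCR := connectingMapIsAlphaBar D R hk hk' hvanR hθ
  obtain ⟨θ⟩ := hθ
  have hCω := connectingMapIsAlphaBar D ω hk hk' hvanω ⟨θ ≪≫ₗ (extTargetEquiv e k).symm⟩
  have hnu := D.nu_injective hωF.1
  refine ⟨D, D.eq_of_injective hF.1 hωF.1, D.alphaBar_surjective, hnu, hCω, hCR, ?_,
    D.lamBar_injective hM.1, D.range_lamBar, fun hrefl => ?_⟩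
  all_goals obtain ⟨Φ, Γ, -, -, hΓ⟩ := hCR.2 θ
  · have := hW (k - 1) (by omega)
    refine A.nonempty_ext_equiv R hk' Φ D.alphaBar fun ζ => ?_
    rw [← Γ.map_eq_zero_iff, hΓ, map_eq_zero_iff _ hnu]
  · have : Subsingleton (ExtMod R (R ⧸ I) R (1 + k)) := hvan _ (by omega)
    have : Subsingleton (ExtMod R (idealMul I F) R k) := subsingleton_ext_idealMul R (by omega)
    rw [D.isReflexiveWith_iff ⟨D.flip_nu_injective e hM.1 hrefl,
      D.flip_nu_surjective e hωF.1 hr hregω hrefl⟩, ← A.beta_surjective_iff R hk',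
      ← Function.Surjective.of_comp_iff' Γ.bijective,
      show Γ ∘ A.beta R hk' = (D.nu ∘ D.alphaBar) ∘ Φ from funext hΓ,
      Function.Surjective.of_comp_iff _ Φ.surjective,
      Function.Surjective.of_comp_iff _ D.alphaBar_surjective]
    exact ⟨fun h => ⟨hnu, h⟩, fun h => h.2⟩
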